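/- Let $(M,g)$ be a compact connected smooth Riemannian manifold (without boundary) of dimension $n\ge 3$ whose Ricci tensor $\mathrm{Ric}$ is positive definite, so that $\mathrm{Ric}$ is itself a Riemannian metric on $M$. For a one-form $\theta$ put $\delta^*\theta=\tfrac12 L_{\theta^\#}g$, where $\theta^\#$ is the $g$-dual vector field, and call a smooth symmetric two-tensor $\varphi$ a TT-tensor if its divergence $\delta\varphi=-\sum_i(\nabla_{e_i}\varphi)(e_i,\cdot)$ and its trace $\mathrm{trace}_g\varphi$ vanish. A vector field $\xi$ is an infinitesimal harmonic transformation if $\mathrm{trace}_g(L_\xi\nabla)=0$, where $\nabla$ is the Levi-Civita connection of $g$ (that is, the flow of $\xi$ is harmonic to first order). For a smooth map $f:(M,g)\to(\bar M,\bar g)$ let $e(f)=\mathrm{trace}_g(f^*\bar g)$ be its energy density and $E(f)=\tfrac12\int_M e(f)\,dv_g$ its energy; let $s=\mathrm{trace}_g\mathrm{Ric}$ be the scalar curvature and $s(M)=\int_M s\,dv_g$ the total scalar curvature. Let $\mathrm{Ric}=(\delta^*\theta+\lambda g)+\varphi_{TT}$ be the York decomposition of $\mathrm{Ric}$, with $\theta$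 a smooth one-form, $\lambda$ a smooth function and $\varphi_{TT}$ a TT-tensor. Then the identity map $\mathrm{id}_M:(M,g)\to(M,\mathrm{Ric})$ is harmonic (its tension field vanishes). If moreover $\xi=\theta^\#$ is an infinitesimal harmonic transformation, then $\lambda$ is constant and $$\int_M e(\mathrm{id}_M)\,dv_g=s(M)=n\lambda\,\mathrm{Vol}(M,g),\qquad\text{i.e.}\qquad E(\mathrm{id}_M)=\tfrac12\,s(M)=\tfrac n2\,\lambda\,\mathrm{Vol}(M,g).$$ (Thus the energy equals the total scalar curvature if it is normalised without the factor $\tfrac12$.) -/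

import Mathlib

open MeasureTheory Bundle
open scoped Manifold ContDiff

noncomputable section

namespace RiemGeom

/-- Vector fields (not assumed smooth) on an `n`-manifold `M`. -/
abbrev VField (n : ℕ) (M : Type*) [TopologicalSpace M]
    [ChartedSpace (EuclideanSpace ℝ (Fin n)) M] :=
  Π x : M, TangentSpace (𝓡 n) x

/-- Fields of one-forms (not assumed smooth). -/
abbrev OneForm (n : ℕ) (M : Type*) [TopologicalSpace M]
    [ChartedSpace (EuclideanSpace ℝ (Fin n)) M] :=
  Π x : M, TangentSpace (𝓡 n) x →L[ℝ] ℝ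

/-- Fields of bilinear forms on the tangent spaces (not assumed smooth). -/
abbrev BilinForm (n : ℕ) (M : Type*) [TopologicalSpace M]
    [ChartedSpace (EuclideanSpace ℝ (Fin n)) M] :=
  Π x : M, TangentSpace (𝓡 n) x →L[ℝ] TangentSpace (𝓡 n) x →L[ℝ] ℝ

/-- The type of the values of a covariant two-tensor field, as functions of two tangent vectors.
All the constructions below are applied to fields that are bilinear at each point. -/
abbrev Tensor2 (n : ℕ) (M : Type*) [TopologicalSpace M]
    [ChartedSpace (EuclideanSpace ℝ (Fin n)) M] :=
  Π x : M, TangentSpace (𝓡 n) x → TangentSpace (𝓡 n) x → ℝ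

/-- Smooth Riemannian metrics on an `n`-manifold `M`. -/
abbrev Metric (n : ℕ) (M : Type*) [TopologicalSpace M]
    [ChartedSpace (EuclideanSpace ℝ (Fin n)) M] [IsManifold (𝓡 n) ∞ M] :=
  ContMDiffRiemannianMetric (𝓡 n) ∞ (EuclideanSpace ℝ (Fin n))
    (fun x : M => TangentSpace (𝓡 n) x)

section Defs

variable {n : ℕ} {M : Type*} [TopologicalSpace M] [ChartedSpace (EuclideanSpace ℝ (Fin n)) M]

/-- A field of bilinear forms, seen as a covariant two-tensor field. -/
def BilinForm.toTensor2 (φ : BilinForm n M) : Tensor2 n M := fun x v w => φ x v w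

/-! ### Metric algebra on a tangent space -/

/-- The vector `w` with `h x w v = α v` for all `v`
(unique, and existing for linear `α`, when `h x` is nondegenerate). -/
def dualVec (h : Tensor2 n M) (x : M) (α : TangentSpace (𝓡 n) x → ℝ) : TangentSpace (𝓡 n) x :=
  Classical.epsilon fun w => ∀ v, h x w v = α v

/-- The vector field `θ^#` dual to the one-form `θ`. -/
def sharp (g : Tensor2 n M) (θ : OneForm n M) : VField n M :=
  fun x => dualVec g x (θ x)

/-- `e` is a `g`-orthonormal basis of `T_x M`. -/
def IsOrthonormalFrame (g : Tensor2 n M) (x : M) (e : Fin n → TangentSpace (𝓡 n) x) : Prop :=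
  ∀ i j, g x (e i) (e j) = if i = j then 1 else 0

/-- A `g`-orthonormal basis of `T_x M`. -/
def orthoFrame (g : Tensor2 n M) (x : M) : Fin n → TangentSpace (𝓡 n) x :=
  Classical.epsilon (IsOrthonormalFrame g x)

/-- The trace `∑ i, B (e i) (e i)`, over a `g`-orthonormal basis of `T_x M`, of a bilinear map on
`T_x M` with values in any vector space; by bilinearity it does not depend on the basis. -/
def traceAt {V : Type*} [AddCommMonoid V] (g : Tensor2 n M) (x : M)
    (B : TangentSpace (𝓡 n) x → TangentSpace (𝓡 n) x → V) : V :=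
  ∑ i, B (orthoFrame g x i) (orthoFrame g x i)

/-! ### Differential operators

A tangent vector `v` at `x` is extended to a vector field `ext v` that is smooth near `x`; the
expressions below in which such extensions occur do not depend on the extension. -/

/-- A vector field, smooth near `x`, with value `v` at `x`. -/
def ext {x : M} [IsManifold (𝓡 n) 1 M] (v : TangentSpace (𝓡 n) x) : VField n M :=
  FiberBundle.extend (EuclideanSpace ℝ (Fin n)) (E := fun y : M => TangentSpace (𝓡 n) y) v

/-- The Lie bracket of vector fields. -/
def bracket (X Y : VField n M) : VField n M := VectorField.mlieBracket (𝓡 n) X Y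

/-- The derivative at `x` of the function `f` in the direction `v`. -/
def dirDeriv (f : M → ℝ) (x : M) (v : TangentSpace (𝓡 n) x) : ℝ := mvfderiv (𝓡 n) f x v

/-- The right-hand side of the Koszul formula for `h (∇_X Y, Z)`. -/
def koszul (h : Tensor2 n M) (X Y Z : VField n M) (x : M) : ℝ :=
  (1 / 2) * (dirDeriv (fun y => h y (Y y) (Z y)) x (X x)
    + dirDeriv (fun y => h y (X y) (Z y)) x (Y x)
    - dirDeriv (fun y => h y (X y) (Y y)) x (Z x)
    + h x (bracket X Y x) (Z x) - h x (bracket X Z x) (Y x) - h x (bracket Y Z x) (X x))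

variable [IsManifold (𝓡 n) 1 M]

/-- The Levi-Civita connection `∇_X Y` of the (pseudo-)Riemannian metric `h`, determined by the
Koszul formula. -/
def leviCivita (h : Tensor2 n M) (X Y : VField n M) : VField n M :=
  fun x => dualVec h x fun v => koszul h X Y (ext v) x

/-- The curvature `R(X,Y)Z = ∇_X ∇_Y Z - ∇_Y ∇_X Z - ∇_{[X,Y]} Z`. -/
def curvature (g : Tensor2 n M) (X Y Z : VField n M) : VField n M :=
  leviCivita g X (leviCivita g Y Z) - leviCivita g Y (leviCivita g X Z)
    - leviCivita g (bracket X Y) Z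

/-- The Ricci tensor `Ric(v,w) = trace (u ↦ R(u,v)w)`. -/
def ricci (g : Tensor2 n M) : Tensor2 n M := fun x v w =>
  traceAt g x fun u u' => g x (curvature g (ext u) (ext v) (ext w) x) u'

/-- The scalar curvature `trace_g Ric`. -/
def scalarCurvature (g : Tensor2 n M) (x : M) : ℝ := traceAt g x (ricci g x)

/-- The Lie derivative `L_ξ h` of a covariant two-tensor field. -/
def lieDeriv (ξ : VField n M) (h : Tensor2 n M) : Tensor2 n M := fun x v w =>
  dirDeriv (fun y => h y (ext v y) (ext w y)) x (ξ x)
    - h x (bracket ξ (ext v) x) w - h x v (bracket ξ (ext w) x)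

/-- The operator `δ^* θ = (1/2) L_{θ^#} g` on one-forms. -/
def deltaStar (g : Tensor2 n M) (θ : OneForm n M) : Tensor2 n M := fun x v w =>
  (1 / 2) * lieDeriv (sharp g θ) g x v w

/-- The covariant derivative `(∇_z φ)(v,w)` of a covariant two-tensor field. -/
def covDeriv (g φ : Tensor2 n M) (x : M) (z v w : TangentSpace (𝓡 n) x) : ℝ :=
  dirDeriv (fun y => φ y (ext v y) (ext w y)) x z
    - φ x (leviCivita g (ext z) (ext v) x) w - φ x v (leviCivita g (ext z) (ext w) x)

/-- The divergence `(δφ)(v) = - ∑ i, (∇_{e i} φ)(e i, v)` of a covariant two-tensor field. -/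
def divergence (g φ : Tensor2 n M) (x : M) (v : TangentSpace (𝓡 n) x) : ℝ :=
  - traceAt g x fun u u' => covDeriv g φ x u u' v

/-- The Lie derivative of the Levi-Civita connection,
`(L_ξ ∇)(X,Y) = [ξ, ∇_X Y] - ∇_{[ξ,X]} Y - ∇_X [ξ,Y]`, which is tensorial in `X` and `Y`. -/
def lieDerivConnection (g : Tensor2 n M) (ξ : VField n M) (x : M)
    (v w : TangentSpace (𝓡 n) x) : TangentSpace (𝓡 n) x :=
  bracket ξ (leviCivita g (ext v) (ext w)) x
    - leviCivita g (bracket ξ (ext v)) (ext w) x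
    - leviCivita g (ext v) (bracket ξ (ext w)) x

/-- `ξ` is an infinitesimal harmonic transformation: `trace_g (L_ξ ∇) = 0`. The left-hand side is
the derivative at `t = 0` of `trace_g (φ_t^* ∇ - ∇)`, the tension field of the flow `φ_t` of `ξ`
pulled back by `φ_t`, so this says that the flow is harmonic to first order. -/
def IsInfinitesimalHarmonic (g : Tensor2 n M) (ξ : VField n M) : Prop :=
  ∀ x, traceAt g x (lieDerivConnection g ξ x) = 0

/-! ### Smooth tensor fields and TT-tensors -/

/-- Smooth one-forms. -/
def IsSmoothOneForm (θ : OneForm n M) : Prop :=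
  ContMDiff (𝓡 n) ((𝓡 n).prod 𝓘(ℝ, EuclideanSpace ℝ (Fin n) →L[ℝ] ℝ)) ∞
    fun x => TotalSpace.mk' (EuclideanSpace ℝ (Fin n) →L[ℝ] ℝ)
      (E := fun x : M => TangentSpace (𝓡 n) x →L[ℝ] Trivial M ℝ x) x (θ x)

/-- Smooth fields of bilinear forms. -/
def IsSmoothBilinForm (φ : BilinForm n M) : Prop :=
  ContMDiff (𝓡 n) ((𝓡 n).prod 𝓘(ℝ, EuclideanSpace ℝ (Fin n) →L[ℝ]
      EuclideanSpace ℝ (Fin n) →L[ℝ] ℝ)) ∞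
    fun x => TotalSpace.mk'
      (EuclideanSpace ℝ (Fin n) →L[ℝ] EuclideanSpace ℝ (Fin n) →L[ℝ] ℝ)
      (E := fun x : M => TangentSpace (𝓡 n) x →L[ℝ] TangentSpace (𝓡 n) x →L[ℝ] Trivial M ℝ x)
      x (φ x)

/-- `φ` is a TT-tensor: a smooth symmetric covariant two-tensor field that is
divergence free and trace free with respect to `g`. -/
structure IsTT (g : Tensor2 n M) (φ : BilinForm n M) : Prop where
  smooth : IsSmoothBilinForm φ
  symm : ∀ x v w, φ x v w = φ x w v
  divergence_eq_zero : ∀ x v, divergence g φ.toTensor2 x v = 0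
  trace_eq_zero : ∀ x, traceAt g x (φ.toTensor2 x) = 0

/-! ### Harmonicity of the identity map -/

/-- The second fundamental form `(Df_*)(X,Y) = ∇'_X f_* Y - f_* ∇_X Y` of the identity map
`(M,g) → (M,h)`. -/
def secondFundamentalFormId (g h : Tensor2 n M) (x : M) (v w : TangentSpace (𝓡 n) x) :
    TangentSpace (𝓡 n) x :=
  leviCivita h (ext v) (ext w) x - leviCivita g (ext v) (ext w) x

/-- The identity map `(M,g) → (M,h)` is harmonic: its tension field `trace_g (D id_*)` vanishes. -/
def IsHarmonicId (g h : Tensor2 n M) : Prop :=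
  ∀ x, traceAt g x (secondFundamentalFormId g h x) = 0

end Defs

/-! ### Riemannian volume, energy, total scalar curvature -/

section Volume

variable {n : ℕ} {M : Type*} [TopologicalSpace M] [ChartedSpace (EuclideanSpace ℝ (Fin n)) M]

/-- The coordinate vector field `∂_i` of the chart at `c`, at the point with coordinates `y`. -/
def coordVec (c : M) (y : EuclideanSpace ℝ (Fin n)) (i : Fin n) :
    TangentSpace (𝓡 n) ((extChartAt (𝓡 n) c).symm y) :=
  mfderiv 𝓘(ℝ, EuclideanSpace ℝ (Fin n)) (𝓡 n) (extChartAt (𝓡 n) c).symm y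
    (EuclideanSpace.single i (1 : ℝ) : EuclideanSpace ℝ (Fin n))

/-- The density `√(det (g (∂_i, ∂_j)))` in the chart at `c`. -/
def volDensity (g : Tensor2 n M) (c : M) (y : EuclideanSpace ℝ (Fin n)) : ℝ :=
  √(Matrix.det (Matrix.of fun i j : Fin n =>
    g ((extChartAt (𝓡 n) c).symm y) (coordVec c y i) (coordVec c y j)))

variable [MeasurableSpace M]

/-- The measure `√(det g) dy` of the chart at `c`, carried over to `M`. -/
def chartVolume (g : Tensor2 n M) (c : M) : Measure M :=
  Measure.map (extChartAt (𝓡 n) c).symm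
    ((volume.restrict (extChartAt (𝓡 n) c).target).withDensity
      fun y => ENNReal.ofReal (volDensity g c y))

variable [IsManifold (𝓡 n) ∞ M] [T2Space M] [SigmaCompactSpace M]

variable (n M) in
/-- A smooth partition of unity subordinate to the chart domains. -/
def chartPartition : SmoothPartitionOfUnity M (𝓡 n) M Set.univ :=
  (SmoothPartitionOfUnity.exists_isSubordinate_chartAt_source (𝓡 n) M).choose

/-- The Riemannian volume measure, patched together from the measures `√(det g) dy` of the charts
by a partition of unity (on which it does not depend). -/
def volumeMeasure (g : Tensor2 n M) : Measure M :=
  Measure.sum fun c : M =>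
    (chartVolume g c).withDensity fun x => ENNReal.ofReal (chartPartition n M c x)

/-- The volume of `(M,g)`. -/
def vol (g : Tensor2 n M) : ℝ := (volumeMeasure g).real Set.univ

/-- The total scalar curvature `∫ s dv_g`. -/
def totalScalarCurvature (g : Tensor2 n M) : ℝ :=
  ∫ x, scalarCurvature g x ∂(volumeMeasure g)

end Volume

section Energy

variable {n m : ℕ} {M : Type*} [TopologicalSpace M] [ChartedSpace (EuclideanSpace ℝ (Fin n)) M]
  {N : Type*} [TopologicalSpace N] [ChartedSpace (EuclideanSpace ℝ (Fin m)) N]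

/-- The pullback `f^* h` of a covariant two-tensor field under a map `f : M → N`. -/
def pullback (f : M → N) (h : Tensor2 m N) : Tensor2 n M := fun x v w =>
  h (f x) (mfderiv (𝓡 n) (𝓡 m) f x v) (mfderiv (𝓡 n) (𝓡 m) f x w)

/-- The energy density `e(f) = trace_g (f^* h)` of a map `f : (M,g) → (N,h)`. -/
def energyDensity (g : Tensor2 n M) (h : Tensor2 m N) (f : M → N) (x : M) : ℝ :=
  traceAt g x (pullback f h x)

/-- The energy `E(f) = (1/2) ∫ e(f) dv_g` of a map `f : (M,g) → (N,h)`. -/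
def energy [MeasurableSpace M] [IsManifold (𝓡 n) ∞ M] [T2Space M] [SigmaCompactSpace M]
    (g : Tensor2 n M) (h : Tensor2 m N) (f : M → N) : ℝ :=
  (1 / 2) * ∫ x, energyDensity g h f x ∂(volumeMeasure g)

end Energy

/-- The metric `g`, seen as a covariant two-tensor field. -/
def Metric.tensor {n : ℕ} {M : Type*} [TopologicalSpace M]
    [ChartedSpace (EuclideanSpace ℝ (Fin n)) M] [IsManifold (𝓡 n) ∞ M]
    (g : Metric n M) : Tensor2 n M := fun x v w => g.inner x v w

end RiemGeom

end

/-
Everything is governed by the Bianchi operator `β ↦ div β - ½ d (tr β)` of `g`. The tension field of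
the identity map `(M, g) → (M, h)` is the `h`-dual of its value at `h`, so the identity map to
`(M, Ric)` is harmonic because that value vanishes at `Ric`, by the contracted second Bianchi
identity. On the terms of the York decomposition of `Ric` the same operator takes the value
`½ trace_g (L_ξ ∇)`, up to `g`-duality, at `δ^* θ`, zero at the TT-part, and `(1 - n / 2) dλ` at
`λ g`; hence `dλ = 0` if `n ≠ 2` and `ξ` is infinitesimally harmonic. The trace of the decomposition
is then `s = div ξ + n λ`, and `div ξ` integrates to zero.
-/

set_option maxSynthPendingDepth 3

namespace LocalGeom

open Module Filter Topology

/-- Continuous bilinear forms on `E`: the values, in a coordinate domain of a manifold, of a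
covariant two-tensor field. -/
abbrev Bil (E : Type*) [NormedAddCommGroup E] [NormedSpace ℝ E] := E →L[ℝ] E →L[ℝ] ℝ

/-- Symmetric nondegenerate bilinear forms: the values of a semi-Riemannian metric. -/
structure IsScalarProduct {E : Type*} [NormedAddCommGroup E] [NormedSpace ℝ E] (B : Bil E) :
    Prop where
  symm : ∀ v w, B v w = B w v
  nondegenerate : ∀ v, (∀ w, B v w = 0) → v = 0

/-- Symmetric positive definite bilinear forms: the values of a Riemannian metric. -/
structure IsInner {E : Type*} [NormedAddCommGroup E] [NormedSpace ℝ E] (B : Bil E) : Prop where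
  symm : ∀ v w, B v w = B w v
  pos : ∀ v, v ≠ 0 → 0 < B v v

section ScalarProduct

variable {E : Type*} [NormedAddCommGroup E] [NormedSpace ℝ E] {B : Bil E}

theorem IsInner.isScalarProduct (hB : IsInner B) : IsScalarProduct B where
  symm := hB.symm
  nondegenerate v hv := by
    by_contra hne
    exact (hB.pos v hne).ne' (hv v)

theorem IsScalarProduct.eq_of_forall (hB : IsScalarProduct B) {v w : E}
    (h : ∀ z, B v z = B w z) : v = w :=
  sub_eq_zero.1 <| hB.nondegenerate _ fun z => by rw [map_sub, sub_apply, h, sub_self]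

theorem IsScalarProduct.exists_equiv [FiniteDimensional ℝ E] (hB : IsScalarProduct B) :
    ∃ e : E ≃L[ℝ] (E →L[ℝ] ℝ), (e : E →L[ℝ] (E →L[ℝ] ℝ)) = B := by
  have hinj : Function.Injective (B : E →ₗ[ℝ] (E →L[ℝ] ℝ)) := fun _ _ h =>
    hB.eq_of_forall fun z => DFunLike.congr_fun h z
  have hfin : finrank ℝ E = finrank ℝ (E →L[ℝ] ℝ) := by
    rw [← (LinearMap.toContinuousLinearMap (𝕜 := ℝ) (E := E) (F' := ℝ)).finrank_eq]
    exact (Subspace.dual_finrank_eq (K := ℝ) (V := E)).symm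
  exact ⟨(LinearEquiv.ofInjectiveOfFinrankEq (B : E →ₗ[ℝ] (E →L[ℝ] ℝ)) hinj
    hfin).toContinuousLinearEquiv, rfl⟩

theorem IsScalarProduct.inverse_apply [FiniteDimensional ℝ E] (hB : IsScalarProduct B)
    (α : E →L[ℝ] ℝ) (v : E) : B (B.inverse α) v = α v := by
  obtain ⟨e, rfl⟩ := hB.exists_equiv
  simp

end ScalarProduct

/-- The basis `e` is orthonormal for `B`. -/
def IsOrthonormal {E ι : Type*} [NormedAddCommGroup E] [NormedSpace ℝ E] [DecidableEq ι]
    (B : Bil E) (e : Basis ι ℝ E) : Prop :=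
  ∀ i j, B (e i) (e j) = if i = j then 1 else 0

section Frame

variable {E : Type*} [NormedAddCommGroup E] [NormedSpace ℝ E] {B : Bil E}

theorem IsInner.exists_isOrthonormal [FiniteDimensional ℝ E] (hB : IsInner B) :
    ∃ e : Basis (Fin (finrank ℝ E)) ℝ E, IsOrthonormal B e := by
  let B' : LinearMap.BilinForm ℝ E :=
    LinearMap.mk₂ ℝ (fun v w => B v w) (by simp) (by simp) (by simp) (by simp)
  obtain ⟨b, hb⟩ := LinearMap.BilinForm.exists_orthogonal_basis (B := B') ⟨fun v w => hB.symm v w⟩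
  have hpos : ∀ i, 0 < B (b i) (b i) := fun i => hB.pos _ (b.ne_zero i)
  refine ⟨b.isUnitSMul (w := fun i => (√(B (b i) (b i)))⁻¹) fun i =>
    (inv_ne_zero (Real.sqrt_pos.2 (hpos i)).ne').isUnit, fun i j => ?_⟩
  simp only [Basis.isUnitSMul_apply, map_smul, smul_apply, smul_eq_mul]
  split_ifs with hij
  · subst hij
    have hsq := Real.mul_self_sqrt (hpos i).le
    have hne := (Real.sqrt_pos.2 (hpos i)).ne'
    field_simp
    rw [sq, hsq]
  · rw [show B (b i) (b j) = 0 from hb hij, mul_zero, mul_zero]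

theorem exists_basis_of_orthonormal_family [FiniteDimensional ℝ E] {ι : Type*} [Fintype ι]
    [DecidableEq ι] {v : ι → E} (hv : ∀ i j, B (v i) (v j) = if i = j then 1 else 0)
    (hcard : Fintype.card ι = finrank ℝ E) : ∃ e : Basis ι ℝ E, IsOrthonormal B e ∧ ⇑e = v := by
  have hli : LinearIndependent ℝ v := by
    rw [Fintype.linearIndependent_iff]
    intro c hc i
    have hBc : B (∑ j, c j • v j) (v i) = 0 := by rw [hc, map_zero, zero_apply]
    simpa [map_sum, sum_apply, hv _ _] using hBc
  have hcoe : ⇑(Basis.mk hli (hli.span_eq_top_of_card_eq_finrank' hcard).ge) = v :=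
    Basis.coe_mk _ _
  exact ⟨_, fun i j => by rw [hcoe, hv], hcoe⟩

variable {ι : Type*} [DecidableEq ι] {e : Basis ι ℝ E}

theorem IsOrthonormal.repr_apply (he : IsOrthonormal B e) (v : E) (i : ι) :
    e.repr v i = B v (e i) := by
  have hcoord : e.coord i = (B.flip (e i) : E →ₗ[ℝ] ℝ) := e.ext fun j => by
    simp [he j i, Finsupp.single_apply]
  exact DFunLike.congr_fun hcoord v

variable [Fintype ι]

theorem IsOrthonormal.sum_mul (he : IsOrthonormal B e) (α : E →L[ℝ] ℝ) (v : E) :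
    ∑ i, B v (e i) * α (e i) = α v := by
  conv_rhs => rw [← e.sum_repr v]
  simp [map_sum, he.repr_apply]

variable [FiniteDimensional ℝ E]

variable (E) in
/-- The trace of endomorphisms of `E`, as a continuous linear form. -/
noncomputable def traceL : (E →L[ℝ] E) →L[ℝ] ℝ :=
  LinearMap.toContinuousLinearMap
    ((LinearMap.trace ℝ E).comp (ContinuousLinearMap.coeLM ℝ : (E →L[ℝ] E) →ₗ[ℝ] (E →ₗ[ℝ] E)))

theorem traceL_comp_comm (S T : E →L[ℝ] E) : traceL E (S.comp T) = traceL E (T.comp S) :=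
  LinearMap.trace_mul_comm ℝ (S : E →ₗ[ℝ] E) (T : E →ₗ[ℝ] E)

theorem IsOrthonormal.traceL_eq (he : IsOrthonormal B e) (T : E →L[ℝ] E) :
    traceL E T = ∑ i, B (T (e i)) (e i) := by
  change LinearMap.trace ℝ E (T : E →ₗ[ℝ] E) = _
  rw [LinearMap.trace_eq_matrix_trace ℝ e, Matrix.trace]
  refine Finset.sum_congr rfl fun i _ => ?_
  rw [Matrix.diag_apply, LinearMap.toMatrix_apply, he.repr_apply]
  rfl

/-- The trace of the bilinear form `β` with respect to the scalar product `B`. -/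
noncomputable def trBil (B β : Bil E) : ℝ := traceL E (B.inverse.comp β)

theorem IsOrthonormal.trBil_eq (he : IsOrthonormal B e) (hB : IsScalarProduct B) (β : Bil E) :
    trBil B β = ∑ i, β (e i) (e i) := by
  rw [trBil, he.traceL_eq]
  exact Finset.sum_congr rfl fun i _ => hB.inverse_apply _ _

end Frame

section Calculus

variable {E E' F : Type*} [NormedAddCommGroup E] [NormedSpace ℝ E] [NormedAddCommGroup E']
  [NormedSpace ℝ E'] [NormedAddCommGroup F] [NormedSpace ℝ F] {y : E}

theorem fderiv_apply₁ {H : E → E' →L[ℝ] F} {V : E → E'} (hH : DifferentiableAt ℝ H y)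
    (hV : DifferentiableAt ℝ V y) (a : E) :
    fderiv ℝ (fun z => H z (V z)) y a = fderiv ℝ H y a (V y) + H y (fderiv ℝ V y a) := by
  rw [fderiv_clm_apply hH hV]
  simp [add_comm]

theorem fderiv_apply₂ {H : E → E →L[ℝ] E →L[ℝ] F} {V W : E → E} (hH : DifferentiableAt ℝ H y)
    (hV : DifferentiableAt ℝ V y) (hW : DifferentiableAt ℝ W y) (a : E) :
    fderiv ℝ (fun z => H z (V z) (W z)) y a =
      fderiv ℝ H y a (V y) (W y) + H y (fderiv ℝ V y a) (W y) + H y (V y) (fderiv ℝ W y a) := by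
  rw [fderiv_apply₁ (hH.clm_apply hV) hW, fderiv_apply₁ hH hV]
  simp

theorem fderiv_apply_const₁ {H : E → E' →L[ℝ] F} (hH : DifferentiableAt ℝ H y) (a : E) (b : E') :
    fderiv ℝ (fun z => H z b) y a = fderiv ℝ H y a b := by
  rw [fderiv_apply₁ hH (differentiableAt_const b)]
  simp

theorem fderiv_apply_const₂ {H : E → E →L[ℝ] E →L[ℝ] F} (hH : DifferentiableAt ℝ H y)
    (a b c : E) : fderiv ℝ (fun z => H z b c) y a = fderiv ℝ H y a b c := by
  rw [fderiv_apply_const₁ (hH.clm_apply (differentiableAt_const b)), fderiv_apply_const₁ hH]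

theorem fderiv_apply_const₃ {H : E → E →L[ℝ] E →L[ℝ] E →L[ℝ] F} (hH : DifferentiableAt ℝ H y)
    (a b c d : E) : fderiv ℝ (fun z => H z b c d) y a = fderiv ℝ H y a b c d := by
  rw [fderiv_apply_const₁ ((hH.clm_apply (differentiableAt_const b)).clm_apply
    (differentiableAt_const c)), fderiv_apply_const₂ hH]

theorem fderiv_fderiv_comm {H : E → F} (hH : ContDiffAt ℝ ∞ H y) (a b : E) :
    fderiv ℝ (fderiv ℝ H) y a b = fderiv ℝ (fderiv ℝ H) y b a :=
  hH.isSymmSndFDerivAt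
    (by simp only [minSmoothness_of_isRCLikeNormedField]; exact ENat.LEInfty.out) a b

theorem contDiffAt_fderiv {H : E → F} (hH : ContDiffAt ℝ ∞ H y) :
    ContDiffAt ℝ ∞ (fderiv ℝ H) y :=
  hH.fderiv_right (by simp)

theorem fderiv_symm {H : E → E →L[ℝ] E →L[ℝ] F} (hH : DifferentiableAt ℝ H y)
    (hs : ∀ᶠ z in 𝓝 y, ∀ v w, H z v w = H z w v) (a b c : E) :
    fderiv ℝ H y a b c = fderiv ℝ H y a c b := by
  have hbc : (fun z => H z b c) =ᶠ[𝓝 y] fun z => H z c b := hs.mono fun z hz => hz b c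
  rw [← fderiv_apply_const₂ hH, ← fderiv_apply_const₂ hH, hbc.fderiv_eq]

theorem contDiffAt_clm_apply_iff [FiniteDimensional ℝ E] {H : E → E →L[ℝ] F} :
    ContDiffAt ℝ ∞ H y ↔ ∀ a, ContDiffAt ℝ ∞ (fun z => H z a) y := by
  refine ⟨fun h a => h.clm_apply contDiffAt_const, fun h => ?_⟩
  let b := finBasis ℝ E
  let coord := fun i => LinearMap.toContinuousLinearMap (b.coord i)
  have hH : H = fun z => ∑ i, ContinuousLinearMap.smulRightL ℝ E F (coord i) (H z (b i)) := by
    ext z v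
    conv_lhs => rw [← b.sum_repr v, map_sum]
    simp [coord]
  rw [hH]
  exact ContDiffAt.sum fun i _ => (ContinuousLinearMap.contDiff _).contDiffAt.comp y (h (b i))

end Calculus

section Connection

variable {E : Type*} [NormedAddCommGroup E] [NormedSpace ℝ E]

/-- The trilinear form `(a, b, c) ↦ ½ (D a b c + D b a c - D c a b)` of the Koszul formula: it
recovers a torsion-free connection from the derivatives `D a b c` of the metric. -/
noncomputable def koszulForm (D : E →L[ℝ] Bil E) : E →L[ℝ] Bil E :=
  (1 / 2 : ℝ) • (D + D.flip -
    ((ContinuousLinearMap.flipₗᵢ ℝ E E ℝ).toContinuousLinearEquiv : Bil E →L[ℝ] Bil E).comp D.flip)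

theorem koszulForm_apply (D : E →L[ℝ] Bil E) (a b c : E) :
    koszulForm D a b c = (1 / 2) * (D a b c + D b a c - D c a b) := by
  simp [koszulForm]

theorem koszulForm_add (C D : E →L[ℝ] Bil E) :
    koszulForm (C + D) = koszulForm C + koszulForm D := by
  ext a b c
  simp only [koszulForm_apply, add_apply]
  ring

theorem koszulForm_smul (r : ℝ) (D : E →L[ℝ] Bil E) : koszulForm (r • D) = r • koszulForm D := by
  ext a b c
  simp only [koszulForm_apply, smul_apply, smul_eq_mul]
  ring

/-- The action `(A · β) (b, c) = β (A b, c) + β (b, A c)` of endomorphisms on bilinear forms, as a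
function of `A`; it is the algebraic part of covariant and Lie derivatives. -/
noncomputable def leibniz (β : Bil E) : (E →L[ℝ] E) →L[ℝ] Bil E :=
  ContinuousLinearMap.compL ℝ E E (E →L[ℝ] ℝ) β +
    ((ContinuousLinearMap.flipₗᵢ ℝ E E ℝ).toContinuousLinearEquiv : Bil E →L[ℝ] Bil E).comp
      (ContinuousLinearMap.compL ℝ E E (E →L[ℝ] ℝ) β.flip)

@[simp] theorem leibniz_apply (β : Bil E) (A : E →L[ℝ] E) (b c : E) :
    leibniz β A b c = β (A b) c + β b (A c) := by
  simp [leibniz]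

/-- The Christoffel symbols of `G`, as a bilinear map. -/
noncomputable def christoffel (G : E → Bil E) (y : E) : E →L[ℝ] E →L[ℝ] E :=
  (ContinuousLinearMap.compL ℝ E (E →L[ℝ] ℝ) E (G y).inverse).comp (koszulForm (fderiv ℝ G y))

/-- The covariant derivative `(∇_a β) (b, c)` of a field `β` of bilinear forms, with respect to the
Levi-Civita connection of `G`. -/
noncomputable def nablaBil (G β : E → Bil E) (y : E) : E →L[ℝ] Bil E :=
  fderiv ℝ β y - (leibniz (β y)).comp (christoffel G y)

theorem nablaBil_apply (G β : E → Bil E) (y a b c : E) :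
    nablaBil G β y a b c =
      fderiv ℝ β y a b c - (β y (christoffel G y a b) c + β y b (christoffel G y a c)) := by
  simp [nablaBil]

/-- `G` is a smooth semi-Riemannian metric on a neighbourhood of `y`. -/
def IsMetricNear (G : E → Bil E) (y : E) : Prop :=
  ∀ᶠ z in 𝓝 y, ContDiffAt ℝ ∞ G z ∧ IsScalarProduct (G z)

variable {G β γ : E → Bil E} {y : E}

theorem IsMetricNear.eventually (hG : IsMetricNear G y) : ∀ᶠ z in 𝓝 y, IsMetricNear G z :=
  hG.eventually_nhds

theorem IsMetricNear.contDiffAt (hG : IsMetricNear G y) : ContDiffAt ℝ ∞ G y :=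
  hG.self_of_nhds.1

theorem IsMetricNear.isScalarProduct (hG : IsMetricNear G y) : IsScalarProduct (G y) :=
  hG.self_of_nhds.2

theorem IsMetricNear.differentiableAt (hG : IsMetricNear G y) : DifferentiableAt ℝ G y :=
  hG.contDiffAt.differentiableAt (by simp)

theorem IsMetricNear.differentiableAt_fderiv (hG : IsMetricNear G y) :
    DifferentiableAt ℝ (fderiv ℝ G) y :=
  (contDiffAt_fderiv hG.contDiffAt).differentiableAt (by simp)

theorem IsMetricNear.fderiv_symm (hG : IsMetricNear G y) (a b c : E) :
    fderiv ℝ G y a b c = fderiv ℝ G y a c b :=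
  LocalGeom.fderiv_symm hG.differentiableAt (hG.mono fun _ hz => hz.2.symm) a b c

theorem nablaBil_symm (hβ : DifferentiableAt ℝ β y) (hs : ∀ᶠ z in 𝓝 y, ∀ v w, β z v w = β z w v)
    (a b c : E) : nablaBil G β y a b c = nablaBil G β y a c b := by
  have hy := hs.self_of_nhds
  simp only [nablaBil_apply, fderiv_symm hβ hs a b c, hy _ c, hy b]
  ring

theorem nablaBil_congr (h : β =ᶠ[𝓝 y] γ) : nablaBil G β y = nablaBil G γ y := by
  rw [nablaBil, nablaBil, h.fderiv_eq, h.self_of_nhds]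

theorem nablaBil_add (hβ : DifferentiableAt ℝ β y) (hγ : DifferentiableAt ℝ γ y) :
    nablaBil G (β + γ) y = nablaBil G β y + nablaBil G γ y := by
  ext a b c
  simp only [nablaBil_apply, fderiv_add hβ hγ, Pi.add_apply, add_apply]
  ring

theorem nablaBil_smul {f : E → ℝ} (hf : DifferentiableAt ℝ f y) (hβ : DifferentiableAt ℝ β y) :
    nablaBil G (f • β) y = (fderiv ℝ f y).smulRight (β y) + f y • nablaBil G β y := by
  ext a b c
  simp only [nablaBil_apply, fderiv_smul hf hβ, Pi.smul_apply', add_apply, smul_apply,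
    ContinuousLinearMap.smulRight_apply, smul_eq_mul]
  ring

variable [FiniteDimensional ℝ E]

theorem IsMetricNear.christoffel_spec (hG : IsMetricNear G y) (a b : E) :
    G y (christoffel G y a b) = koszulForm (fderiv ℝ G y) a b := by
  ext c
  exact hG.isScalarProduct.inverse_apply _ _

theorem IsMetricNear.christoffel_symm (hG : IsMetricNear G y) (a b : E) :
    christoffel G y a b = christoffel G y b a := by
  refine hG.isScalarProduct.eq_of_forall fun c => ?_
  rw [hG.christoffel_spec, hG.christoffel_spec, koszulForm_apply, koszulForm_apply,
    hG.fderiv_symm c a b]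
  ring

theorem IsMetricNear.fderiv_eq (hG : IsMetricNear G y) (a b c : E) :
    fderiv ℝ G y a b c = G y (christoffel G y a b) c + G y b (christoffel G y a c) := by
  rw [hG.isScalarProduct.symm b, hG.christoffel_spec, hG.christoffel_spec, koszulForm_apply,
    koszulForm_apply, hG.fderiv_symm a c b, hG.fderiv_symm b a c, hG.fderiv_symm c a b]
  ring

theorem IsMetricNear.nablaBil_self (hG : IsMetricNear G y) : nablaBil G G y = 0 := by
  ext a b c
  rw [nablaBil_apply, hG.fderiv_eq, sub_self]
  rfl

theorem IsMetricNear.contDiffAt_inverse (hG : IsMetricNear G y) :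
    ContDiffAt ℝ ∞ (fun z => (G z).inverse) y := by
  obtain ⟨e, he⟩ := hG.isScalarProduct.exists_equiv
  exact (he ▸ contDiffAt_map_inverse (n := ∞) e).comp y hG.contDiffAt

theorem IsMetricNear.contDiffAt_christoffel (hG : IsMetricNear G y) :
    ContDiffAt ℝ ∞ (christoffel G) y := by
  have hDG := contDiffAt_fderiv hG.contDiffAt
  refine contDiffAt_clm_apply_iff.2 fun a => contDiffAt_clm_apply_iff.2 fun b => ?_
  refine hG.contDiffAt_inverse.clm_apply (contDiffAt_clm_apply_iff.2 fun c => ?_)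
  change ContDiffAt ℝ ∞ (fun z => koszulForm (fderiv ℝ G z) a b c) y
  simp only [koszulForm_apply]
  fun_prop

theorem IsMetricNear.differentiableAt_christoffel (hG : IsMetricNear G y) :
    DifferentiableAt ℝ (christoffel G) y :=
  hG.contDiffAt_christoffel.differentiableAt (by simp)

theorem IsMetricNear.fderiv_christoffel_symm (hG : IsMetricNear G y) (a b c : E) :
    fderiv ℝ (christoffel G) y a b c = fderiv ℝ (christoffel G) y a c b :=
  LocalGeom.fderiv_symm hG.differentiableAt_christoffel
    (hG.eventually.mono fun _ hz => hz.christoffel_symm) a b c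

theorem IsMetricNear.fderiv_christoffel_spec (hG : IsMetricNear G y) (a b c d : E) :
    fderiv ℝ G y a (christoffel G y b c) d + G y (fderiv ℝ (christoffel G) y a b c) d =
      koszulForm (fderiv ℝ (fderiv ℝ G) y a) b c d := by
  have dG := hG.differentiableAt
  have dΓ := hG.differentiableAt_christoffel
  have ddG := hG.differentiableAt_fderiv
  have hspec : (fun z => G z (christoffel G z b c) d) =ᶠ[𝓝 y]
      fun z => (1 / 2) * (fderiv ℝ G z b c d + fderiv ℝ G z c b d - fderiv ℝ G z d b c) :=
    hG.eventually.mono fun z hz => by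
      simp only [hz.christoffel_spec, koszulForm_apply]
  have h := DFunLike.congr_fun (hspec.fderiv_eq (𝕜 := ℝ)) a
  rw [fderiv_apply₂ dG (by fun_prop) (by fun_prop), fderiv_apply_const₂ dΓ,
    fderiv_const_mul (by fun_prop), smul_apply, fderiv_fun_sub (by fun_prop) (by fun_prop),
    fderiv_fun_add (by fun_prop) (by fun_prop), sub_apply, add_apply, fderiv_apply_const₃ ddG,
    fderiv_apply_const₃ ddG, fderiv_apply_const₃ ddG] at h
  simpa only [koszulForm_apply, smul_eq_mul, fderiv_fun_const,
    Pi.zero_apply, zero_apply, map_zero, add_zero] using h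

end Connection

section Curvature

variable {E : Type*} [NormedAddCommGroup E] [NormedSpace ℝ E] {G : E → Bil E} {y : E}

/-- The Riemann curvature tensor `R(a, b) c` of `G`, as a trilinear map. -/
noncomputable def curv (G : E → Bil E) (y : E) : E →L[ℝ] E →L[ℝ] E →L[ℝ] E :=
  let D := fderiv ℝ (christoffel G) y
  let C := (ContinuousLinearMap.compL ℝ E E E).bilinearComp (christoffel G y) (christoffel G y)
  D - D.flip + C - C.flip

theorem curv_apply (G : E → Bil E) (y a b c : E) : curv G y a b c =
    fderiv ℝ (christoffel G) y a b c - fderiv ℝ (christoffel G) y b a c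
      + christoffel G y a (christoffel G y b c) - christoffel G y b (christoffel G y a c) := by
  simp [curv]

theorem curv_swap (G : E → Bil E) (y a b c : E) : curv G y a b c = -curv G y b a c := by
  simp only [curv_apply]
  abel

/-- The covariant derivative `(∇_a R)(b, c) d` of the Riemann curvature tensor. -/
noncomputable def nablaCurv (G : E → Bil E) (y a b c d : E) : E :=
  fderiv ℝ (curv G) y a b c d + christoffel G y a (curv G y b c d)
    - curv G y (christoffel G y a b) c d - curv G y b (christoffel G y a c) d
    - curv G y b c (christoffel G y a d)

variable [FiniteDimensional ℝ E]

theorem IsMetricNear.first_bianchi (hG : IsMetricNear G y) (a b c : E) :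
    curv G y a b c + curv G y b c a + curv G y c a b = 0 := by
  simp only [curv_apply, hG.christoffel_symm b a, hG.christoffel_symm c a,
    hG.christoffel_symm c b, hG.fderiv_christoffel_symm a c b, hG.fderiv_christoffel_symm b c a,
    hG.fderiv_christoffel_symm c b a]
  abel

theorem IsMetricNear.fderiv_fderiv_apply (hG : IsMetricNear G y) (a b c d : E) :
    fderiv ℝ (fderiv ℝ G) y a b c d =
      fderiv ℝ G y a (christoffel G y b c) d + G y (fderiv ℝ (christoffel G) y a b c) d
      + (fderiv ℝ G y a c (christoffel G y b d) + G y c (fderiv ℝ (christoffel G) y a b d)) := by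
  have dG := hG.differentiableAt
  have dΓ := hG.differentiableAt_christoffel
  have hmetric : (fun z => fderiv ℝ G z b c d) =ᶠ[𝓝 y] fun z =>
      G z (christoffel G z b c) d + G z c (christoffel G z b d) :=
    hG.eventually.mono fun z hz => hz.fderiv_eq b c d
  rw [← fderiv_apply_const₃ hG.differentiableAt_fderiv, hmetric.fderiv_eq,
    fderiv_fun_add (by fun_prop) (by fun_prop), add_apply,
    fderiv_apply₂ dG (by fun_prop) (by fun_prop), fderiv_apply₂ dG (by fun_prop) (by fun_prop),
    fderiv_apply_const₂ dΓ, fderiv_apply_const₂ dΓ]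
  simp only [fderiv_fun_const, Pi.zero_apply, zero_apply, map_zero, add_zero]

theorem IsMetricNear.curv_skew (hG : IsMetricNear G y) (a b c d : E) :
    G y (curv G y a b c) d = -G y c (curv G y a b d) := by
  have h := DFunLike.congr_fun (DFunLike.congr_fun (fderiv_fderiv_comm hG.contDiffAt a b) c) d
  simp only [hG.fderiv_fderiv_apply, hG.fderiv_eq] at h
  simp only [curv_apply, map_add, map_sub, add_apply, sub_apply]
  linarith

theorem IsMetricNear.curv_pair_symm (hG : IsMetricNear G y) (a b c d : E) :
    G y (curv G y a b c) d = G y (curv G y c d a) b := by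
  have swap : ∀ a b c d, G y (curv G y a b c) d = -G y (curv G y b a c) d := fun a b c d => by
    rw [curv_swap, map_neg, neg_apply]
  have skew : ∀ a b c d, G y (curv G y a b c) d = -G y (curv G y a b d) c := fun a b c d => by
    rw [hG.curv_skew, hG.isScalarProduct.symm]
  have cyclic : ∀ a b c d,
      G y (curv G y a b c) d + G y (curv G y b c a) d + G y (curv G y c a b) d = 0 :=
    fun a b c d => by
      simpa only [map_add, map_zero, add_apply, zero_apply] using
        congrArg (fun v => G y v d) (hG.first_bianchi a b c)
  linarith [cyclic a b c d, cyclic b c d a, cyclic c d a b, cyclic d a b c, skew a b c d,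
    skew b c a d, skew c d a b, skew d a b c, skew a c d b, skew b d a c, swap d b c a,
    swap c a b d]

theorem IsMetricNear.contDiffAt_curv (hG : IsMetricNear G y) : ContDiffAt ℝ ∞ (curv G) y := by
  have hΓ := hG.contDiffAt_christoffel
  have := contDiffAt_fderiv hΓ
  simp only [contDiffAt_clm_apply_iff, curv_apply]
  intro a b c
  fun_prop

theorem IsMetricNear.differentiableAt_curv (hG : IsMetricNear G y) :
    DifferentiableAt ℝ (curv G) y :=
  hG.contDiffAt_curv.differentiableAt (by simp)

theorem IsMetricNear.fderiv_curv (hG : IsMetricNear G y) (a b c d : E) :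
    fderiv ℝ (curv G) y a b c d =
      fderiv ℝ (fderiv ℝ (christoffel G)) y a b c d - fderiv ℝ (fderiv ℝ (christoffel G)) y a c b d
      + (fderiv ℝ (christoffel G) y a b (christoffel G y c d)
        + christoffel G y b (fderiv ℝ (christoffel G) y a c d))
      - (fderiv ℝ (christoffel G) y a c (christoffel G y b d)
        + christoffel G y c (fderiv ℝ (christoffel G) y a b d)) := by
  have dΓ := hG.differentiableAt_christoffel
  have ddΓ : DifferentiableAt ℝ (fderiv ℝ (christoffel G)) y :=
    (contDiffAt_fderiv hG.contDiffAt_christoffel).differentiableAt (by simp)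
  have hprod : ∀ b c : E, fderiv ℝ (fun z => christoffel G z b (christoffel G z c d)) y a =
      fderiv ℝ (christoffel G) y a b (christoffel G y c d)
        + christoffel G y b (fderiv ℝ (christoffel G) y a c d) := fun b c => by
    rw [fderiv_apply₂ dΓ (differentiableAt_const b) (by fun_prop), fderiv_apply_const₂ dΓ]
    simp
  rw [← fderiv_apply_const₃ hG.differentiableAt_curv]
  simp only [curv_apply]
  rw [fderiv_fun_sub (by fun_prop) (by fun_prop), fderiv_fun_add (by fun_prop) (by fun_prop),
    fderiv_fun_sub (by fun_prop) (by fun_prop)]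
  simp only [add_apply, sub_apply, hprod, fderiv_apply_const₃ ddΓ]

theorem IsMetricNear.second_bianchi (hG : IsMetricNear G y) (a b c d : E) :
    nablaCurv G y a b c d + nablaCurv G y b c a d + nablaCurv G y c a b d = 0 := by
  have hcomm := fderiv_fderiv_comm hG.contDiffAt_christoffel
  have torsion_free : ∀ a b c, curv G y (christoffel G y a b) c d =
      -curv G y c (christoffel G y b a) d := fun a b c => by
    rw [hG.christoffel_symm b a, curv_swap]
  simp only [nablaCurv, hG.fderiv_curv, torsion_free a b c, torsion_free b c a, torsion_free c a b]
  simp only [curv_apply, hcomm b a, hcomm c a, hcomm c b, map_add, map_sub]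
  abel

theorem IsMetricNear.nablaCurv_swap (hG : IsMetricNear G y) (a b c d : E) :
    nablaCurv G y a b c d = -nablaCurv G y a c b d := by
  simp only [nablaCurv, hG.fderiv_curv, curv_swap G y b, curv_swap G y (christoffel G y a b),
    map_neg]
  abel

theorem IsMetricNear.nablaCurv_skew (hG : IsMetricNear G y) (a b c d e : E) :
    G y (nablaCurv G y a b c d) e = -G y d (nablaCurv G y a b c e) := by
  have dG := hG.differentiableAt
  have dR := hG.differentiableAt_curv
  have hskew : (fun z => G z (curv G z b c d) e + G z d (curv G z b c e)) =ᶠ[𝓝 y] fun _ => 0 :=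
    hG.eventually.mono fun z hz => by
      simp only [hz.curv_skew b c d e, neg_add_cancel]
  have h := DFunLike.congr_fun (hskew.fderiv_eq (𝕜 := ℝ)) a
  rw [fderiv_fun_add (by fun_prop) (by fun_prop), add_apply,
    fderiv_apply₂ dG (by fun_prop) (by fun_prop), fderiv_apply₂ dG (by fun_prop) (by fun_prop),
    fderiv_apply_const₃ dR, fderiv_apply_const₃ dR] at h
  simp only [hG.fderiv_eq, fderiv_fun_const, Pi.zero_apply, zero_apply, map_zero] at h
  simp only [nablaCurv, map_add, map_sub, add_apply, sub_apply]
  linarith [hG.curv_skew (christoffel G y a b) c d e, hG.curv_skew b (christoffel G y a c) d e,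
    hG.curv_skew b c (christoffel G y a d) e, hG.curv_skew b c d (christoffel G y a e)]

/-- The Ricci tensor `Ric(b, c) = tr (a ↦ R(a, b) c)` of `G`. -/
noncomputable def ric (G : E → Bil E) (y : E) : Bil E :=
  (ContinuousLinearMap.compL ℝ E (E →L[ℝ] E) ℝ (traceL E)).comp
    (((ContinuousLinearMap.flipₗᵢ ℝ E E E).toContinuousLinearEquiv :
      (E →L[ℝ] E →L[ℝ] E) →L[ℝ] (E →L[ℝ] E →L[ℝ] E)).comp (curv G y).flip)

theorem ric_apply (G : E → Bil E) (y b c : E) :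
    ric G y b c = traceL E (((curv G y).flip b).flip c) := rfl

theorem IsOrthonormal.ric_eq {ι : Type*} [Fintype ι] [DecidableEq ι] {e : Basis ι ℝ E}
    {B : Bil E} (he : IsOrthonormal B e) (G : E → Bil E) (y b c : E) :
    ric G y b c = ∑ i, B (curv G y (e i) b c) (e i) := by
  rw [ric_apply, he.traceL_eq]
  simp only [ContinuousLinearMap.flip_apply]

theorem IsMetricNear.ric_symm (hG : IsMetricNear G y) (hpos : IsInner (G y)) (b c : E) :
    ric G y b c = ric G y c b := by
  obtain ⟨e, he⟩ := hpos.exists_isOrthonormal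
  simp only [he.ric_eq]
  refine Finset.sum_congr rfl fun i _ => ?_
  rw [hG.curv_pair_symm, curv_swap, map_neg, neg_apply, hG.curv_skew, neg_neg,
    hG.isScalarProduct.symm]

theorem IsMetricNear.contDiffAt_ric (hG : IsMetricNear G y) : ContDiffAt ℝ ∞ (ric G) y := by
  have hR := hG.contDiffAt_curv
  refine contDiffAt_clm_apply_iff.2 fun b => contDiffAt_clm_apply_iff.2 fun c => ?_
  refine (traceL E).contDiff.contDiffAt.comp y (contDiffAt_clm_apply_iff.2 fun a => ?_)
  change ContDiffAt ℝ ∞ (fun z => curv G z a b c) y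
  fun_prop

theorem IsMetricNear.differentiableAt_ric (hG : IsMetricNear G y) : DifferentiableAt ℝ (ric G) y :=
  hG.contDiffAt_ric.differentiableAt (by simp)

end Curvature

section Bianchi

variable {E : Type*} [NormedAddCommGroup E] [NormedSpace ℝ E] {G H β γ : E → Bil E} {y : E}

/-- The Bianchi operator `div β - ½ d (tr β)` of the metric `G`, computed in an orthonormal basis
`e` at `y`. -/
noncomputable def bianchiOp {ι : Type*} [Fintype ι] (G β : E → Bil E) (y : E) (e : Basis ι ℝ E) :
    E →L[ℝ] ℝ :=
  ∑ i, koszulForm (nablaBil G β y) (e i) (e i)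

/-- The Lie derivative of the field `G` of bilinear forms along the vector field `ξ`. -/
noncomputable def lieBil (ξ : E → E) (G : E → Bil E) (y : E) : Bil E :=
  fderiv ℝ G y (ξ y) + leibniz (G y) (fderiv ℝ ξ y)

/-- The Lie derivative, along the vector field `ξ`, of the connection with Christoffel symbols
`Γ`. -/
noncomputable def lieConn (Γ : E → E →L[ℝ] E →L[ℝ] E) (ξ : E → E) (y v w : E) : E :=
  fderiv ℝ Γ y (ξ y) v w - fderiv ℝ ξ y (Γ y v w) + Γ y (fderiv ℝ ξ y v) w
    + Γ y v (fderiv ℝ ξ y w) + fderiv ℝ (fderiv ℝ ξ) y v w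

section Algebra

variable {ι : Type*} [Fintype ι] {e : Basis ι ℝ E}

theorem bianchiOp_apply (G β : E → Bil E) (y : E) (e : Basis ι ℝ E) (z : E) :
    bianchiOp G β y e z =
      ∑ i, nablaBil G β y (e i) (e i) z - (1 / 2) * ∑ i, nablaBil G β y z (e i) (e i) := by
  rw [bianchiOp, sum_apply, Finset.mul_sum, ← Finset.sum_sub_distrib]
  refine Finset.sum_congr rfl fun i _ => ?_
  rw [koszulForm_apply]
  ring

theorem bianchiOp_congr (h : β =ᶠ[𝓝 y] γ) : bianchiOp G β y e = bianchiOp G γ y e := by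
  rw [bianchiOp, bianchiOp, nablaBil_congr h]

theorem bianchiOp_add (hβ : DifferentiableAt ℝ β y) (hγ : DifferentiableAt ℝ γ y) :
    bianchiOp G (β + γ) y e = bianchiOp G β y e + bianchiOp G γ y e := by
  simp only [bianchiOp, nablaBil_add hβ hγ, koszulForm_add, add_apply, Finset.sum_add_distrib]

theorem bianchiOp_const_smul (r : ℝ) (hβ : DifferentiableAt ℝ β y) :
    bianchiOp G (r • β) y e = r • bianchiOp G β y e := by
  have hr : nablaBil G (r • β) y = r • nablaBil G β y := by
    ext a b c
    simp only [nablaBil_apply, fderiv_const_smul hβ, Pi.smul_apply, smul_apply, smul_eq_mul]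
    ring
  simp only [bianchiOp, hr, koszulForm_smul, smul_apply, Finset.smul_sum]

end Algebra

theorem contDiffAt_lieBil {ξ : E → E} [FiniteDimensional ℝ E] (hξ : ContDiffAt ℝ ∞ ξ y)
    (hG : ContDiffAt ℝ ∞ G y) : ContDiffAt ℝ ∞ (lieBil ξ G) y := by
  have := contDiffAt_fderiv hG
  have := contDiffAt_fderiv hξ
  refine contDiffAt_clm_apply_iff.2 fun b => contDiffAt_clm_apply_iff.2 fun c => ?_
  simp only [lieBil, add_apply, leibniz_apply]
  fun_prop

theorem lieBil_sum {ι : Type*} (s : Finset ι) {ξ : ι → E → E}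
    (hξ : ∀ i ∈ s, DifferentiableAt ℝ (ξ i) y) (G : E → Bil E) :
    lieBil (fun z => ∑ i ∈ s, ξ i z) G y = ∑ i ∈ s, lieBil (ξ i) G y := by
  simp only [lieBil, fderiv_fun_sum hξ, map_sum, Finset.sum_add_distrib]

theorem fderiv_lieBil [FiniteDimensional ℝ E] {ξ : E → E} (hξ : ContDiffAt ℝ ∞ ξ y)
    (hG : ContDiffAt ℝ ∞ G y) (a b c : E) :
    fderiv ℝ (lieBil ξ G) y a b c =
      fderiv ℝ (fderiv ℝ G) y a (ξ y) b c + fderiv ℝ G y (fderiv ℝ ξ y a) b c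
      + ((fderiv ℝ G y a (fderiv ℝ ξ y b) c + G y (fderiv ℝ (fderiv ℝ ξ) y a b) c)
      + (fderiv ℝ G y a b (fderiv ℝ ξ y c) + G y b (fderiv ℝ (fderiv ℝ ξ) y a c))) := by
  have dG : DifferentiableAt ℝ G y := hG.differentiableAt (by simp)
  have dξ : DifferentiableAt ℝ ξ y := hξ.differentiableAt (by simp)
  have ddG : DifferentiableAt ℝ (fderiv ℝ G) y := (contDiffAt_fderiv hG).differentiableAt (by simp)
  have ddξ : DifferentiableAt ℝ (fderiv ℝ ξ) y := (contDiffAt_fderiv hξ).differentiableAt (by simp)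
  rw [← fderiv_apply_const₂ ((contDiffAt_lieBil hξ hG).differentiableAt (by simp))]
  simp only [lieBil, add_apply, leibniz_apply]
  rw [fderiv_fun_add (by fun_prop) (by fun_prop), fderiv_fun_add (by fun_prop) (by fun_prop)]
  simp only [add_apply]
  rw [fderiv_apply₂ dG (by fun_prop) (by fun_prop), fderiv_apply₂ dG (by fun_prop) (by fun_prop),
    fderiv_apply_const₁ ddξ, fderiv_apply_const₁ ddξ,
    fderiv_apply_const₂ (H := fun z => fderiv ℝ G z (ξ z)) (by fun_prop), fderiv_apply₁ ddG dξ]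
  simp only [fderiv_fun_const, Pi.zero_apply, zero_apply, map_zero, add_zero, add_apply]

variable [FiniteDimensional ℝ E]

theorem IsMetricNear.christoffel_sub (hG : IsMetricNear G y) (hH : IsMetricNear H y) (v w : E) :
    H y (christoffel H y v w - christoffel G y v w) = koszulForm (nablaBil G H y) v w := by
  ext z
  have hs := hH.isScalarProduct.symm
  rw [map_sub, sub_apply, hH.christoffel_spec]
  simp only [koszulForm_apply, nablaBil_apply, hG.christoffel_symm w v, hG.christoffel_symm z v,
    hG.christoffel_symm z w]
  rw [hs w, hs v (christoffel G y w z)]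
  ring

theorem IsMetricNear.sum_christoffel_sub {ι : Type*} [Fintype ι] (hG : IsMetricNear G y)
    (hH : IsMetricNear H y) (e : Basis ι ℝ E) :
    H y (∑ i, (christoffel H y (e i) (e i) - christoffel G y (e i) (e i))) =
      bianchiOp G H y e := by
  simp only [map_sum, hG.christoffel_sub hH, bianchiOp]

theorem IsMetricNear.lieConn_eq (hG : IsMetricNear G y) {ξ : E → E} (hξ : ContDiffAt ℝ ∞ ξ y)
    (v w : E) :
    G y (lieConn (christoffel G) ξ y v w) = koszulForm (nablaBil G (lieBil ξ G) y) v w := by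
  ext z
  have sG := fderiv_fderiv_comm hG.contDiffAt
  have sξ := fderiv_fderiv_comm hξ
  have hs := hG.isScalarProduct.symm
  have hΓ := hG.fderiv_christoffel_spec (ξ y) v w z
  have hspec : ∀ a b c : E, G y (christoffel G y a b) c = koszulForm (fderiv ℝ G y) a b c :=
    fun a b c => by rw [hG.christoffel_spec]
  rw [koszulForm_apply, sG (ξ y) v, sG (ξ y) w, sG (ξ y) z] at hΓ
  simp only [koszulForm_apply, nablaBil_apply, fderiv_lieBil hξ hG.contDiffAt]
  simp only [lieBil, leibniz_apply, lieConn, map_add, map_sub, add_apply, sub_apply,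
    hspec (fderiv ℝ ξ y v), hspec v (fderiv ℝ ξ y w), hspec v w, koszulForm_apply,
    hG.christoffel_symm w v, hG.christoffel_symm z v, hG.christoffel_symm z w,
    sξ w v, sξ z v, sξ z w]
  linarith [hG.fderiv_symm (ξ y) w (christoffel G y v z),
    hs (fderiv ℝ ξ y w) (christoffel G y v z), hs w (fderiv ℝ ξ y (christoffel G y v z)),
    hs w (fderiv ℝ (fderiv ℝ ξ) y v z)]

theorem IsMetricNear.sum_lieConn {ι : Type*} [Fintype ι] (hG : IsMetricNear G y) {ξ : E → E}
    (hξ : ContDiffAt ℝ ∞ ξ y) (e : Basis ι ℝ E) :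
    G y (∑ i, lieConn (christoffel G) ξ y (e i) (e i)) = bianchiOp G (lieBil ξ G) y e := by
  simp only [map_sum, hG.lieConn_eq hξ, bianchiOp]

theorem IsMetricNear.contDiffAt_trBil (hG : IsMetricNear G y) (hβ : ContDiffAt ℝ ∞ β y) :
    ContDiffAt ℝ ∞ (fun z => trBil (G z) (β z)) y :=
  (traceL E).contDiff.contDiffAt.comp y (hG.contDiffAt_inverse.clm_comp hβ)

theorem IsMetricNear.fderiv_inverse (hG : IsMetricNear G y) (a : E) (α : E →L[ℝ] ℝ) (v : E) :
    G y (fderiv ℝ (fun z => (G z).inverse) y a α) v = -fderiv ℝ G y a ((G y).inverse α) v := by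
  have dP : DifferentiableAt ℝ (fun z => (G z).inverse) y :=
    hG.contDiffAt_inverse.differentiableAt (by simp)
  have hinv : fderiv ℝ (fun z => (G z).inverse α) y a = fderiv ℝ (fun z => (G z).inverse) y a α :=
    fderiv_apply_const₁ dP a α
  have hconst : (fun z => G z ((G z).inverse α) v) =ᶠ[𝓝 y] fun _ => α v :=
    hG.eventually.mono fun z hz => hz.isScalarProduct.inverse_apply α v
  have h := DFunLike.congr_fun (hconst.fderiv_eq (𝕜 := ℝ)) a
  rw [fderiv_apply₂ hG.differentiableAt (by fun_prop) (by fun_prop), hinv] at h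
  simp only [fderiv_fun_const, Pi.zero_apply, zero_apply, map_zero] at h
  linarith

variable {ι : Type*} [Fintype ι] [DecidableEq ι] {e : Basis ι ℝ E}

theorem IsMetricNear.fderiv_trBil (hG : IsMetricNear G y) (he : IsOrthonormal (G y) e)
    (hβ : DifferentiableAt ℝ β y) (a : E) :
    fderiv ℝ (fun z => trBil (G z) (β z)) y a = ∑ i, nablaBil G β y a (e i) (e i) := by
  have hinv := hG.isScalarProduct.inverse_apply
  have dP : DifferentiableAt ℝ (fun z => (G z).inverse) y :=
    hG.contDiffAt_inverse.differentiableAt (by simp)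
  have hprod : fderiv ℝ (fun z => trBil (G z) (β z)) y a =
      traceL E ((fderiv ℝ (fun z => (G z).inverse) y a).comp (β y)
        + (G y).inverse.comp (fderiv ℝ β y a)) := by
    have hcomp := (traceL E).hasFDerivAt.comp y (dP.clm_comp hβ).hasFDerivAt
    rw [show fderiv ℝ (fun z => trBil (G z) (β z)) y = _ from hcomp.fderiv, fderiv_clm_comp dP hβ]
    simp [add_comm]
  have hcyclic : ∑ i, G y (christoffel G y a ((G y).inverse (β y (e i)))) (e i) =
      ∑ i, β y (christoffel G y a (e i)) (e i) := by
    have h := traceL_comp_comm (christoffel G y a) ((G y).inverse.comp (β y))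
    rw [he.traceL_eq, he.traceL_eq] at h
    simpa only [ContinuousLinearMap.comp_apply, hinv] using h
  rw [hprod, he.traceL_eq]
  simp only [nablaBil_apply, Finset.sum_sub_distrib, ← hcyclic, add_apply, map_add,
    Finset.sum_add_distrib, ContinuousLinearMap.comp_apply, hG.fderiv_inverse, hinv, hG.fderiv_eq,
    Finset.sum_neg_distrib]
  ring

theorem IsMetricNear.nablaBil_ric (hG : IsMetricNear G y) (he : IsOrthonormal (G y) e)
    (a b c : E) :
    nablaBil G (ric G) y a b c = ∑ i, G y (nablaCurv G y a (e i) b c) (e i) := by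
  have dR := hG.differentiableAt_curv
  have hderiv : fderiv ℝ (ric G) y a b c = ∑ i, G y (fderiv ℝ (curv G) y a (e i) b c) (e i) := by
    rw [← fderiv_apply_const₂ hG.differentiableAt_ric]
    simp only [fun z => he.ric_eq G z b c]
    rw [fderiv_fun_sum (fun i _ => by fun_prop), sum_apply]
    refine Finset.sum_congr rfl fun i _ => ?_
    rw [fderiv_apply₂ (H := fun _ => G y) (by fun_prop) (by fun_prop) (by fun_prop),
      fderiv_apply_const₃ dR]
    simp
  have hcyclic : ∑ i, G y (christoffel G y a (curv G y (e i) b c)) (e i) =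
      ∑ i, G y (curv G y (christoffel G y a (e i)) b c) (e i) := by
    have h := traceL_comp_comm (christoffel G y a) (((curv G y).flip b).flip c)
    rw [he.traceL_eq, he.traceL_eq] at h
    simpa only [ContinuousLinearMap.comp_apply, ContinuousLinearMap.flip_apply] using h
  simp only [nablaBil_apply, nablaCurv, hderiv, he.ric_eq, map_sub, map_add, sub_apply, add_apply,
    Finset.sum_sub_distrib, Finset.sum_add_distrib, hcyclic]
  ring

theorem IsMetricNear.bianchiOp_eq_zero (hG : IsMetricNear G y) (he : IsOrthonormal (G y) e)
    (hβ : DifferentiableAt ℝ β y) (hdiv : ∀ z, ∑ i, nablaBil G β y (e i) (e i) z = 0)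
    (htr : ∀ᶠ z in 𝓝 y, trBil (G z) (β z) = 0) : bianchiOp G β y e = 0 := by
  have htr' : (fun z => trBil (G z) (β z)) =ᶠ[𝓝 y] fun _ => 0 := htr
  ext z
  rw [bianchiOp_apply, hdiv, ← hG.fderiv_trBil he hβ, htr'.fderiv_eq]
  simp

theorem IsMetricNear.bianchiOp_smul_self (hG : IsMetricNear G y) (he : IsOrthonormal (G y) e)
    {lam : E → ℝ} (hlam : DifferentiableAt ℝ lam y) :
    bianchiOp G (lam • G) y e = (1 - (Fintype.card ι : ℝ) / 2) • fderiv ℝ lam y := by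
  have hnabla : ∀ a b c, nablaBil G (lam • G) y a b c = G y c b * fderiv ℝ lam y a := by
    intro a b c
    rw [nablaBil_smul hlam hG.differentiableAt, hG.nablaBil_self, add_apply, smul_apply, zero_apply,
      smul_zero, add_zero, ContinuousLinearMap.smulRight_apply, smul_apply, smul_apply,
      smul_eq_mul, mul_comm, hG.isScalarProduct.symm]
  ext z
  simp only [bianchiOp_apply, hnabla, he.sum_mul, he _ _, if_true, one_mul, Finset.sum_const,
    Finset.card_univ, nsmul_eq_mul, smul_apply, smul_eq_mul]
  ring

theorem IsMetricNear.bianchiOp_ric (hG : IsMetricNear G y) (hpos : ∀ᶠ z in 𝓝 y, IsInner (G z))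
    (he : IsOrthonormal (G y) e) : bianchiOp G (ric G) y e = 0 := by
  have hsymm : ∀ a b c, nablaBil G (ric G) y a b c = nablaBil G (ric G) y a c b :=
    nablaBil_symm hG.differentiableAt_ric
      ((hG.eventually.and hpos).mono fun _ hz => hz.1.ric_symm hz.2)
  ext z
  have hcyclic : ∀ i j, G y (nablaCurv G y z (e i) (e j) (e j)) (e i) =
      G y (nablaCurv G y (e i) (e j) z (e i)) (e j)
        + G y (nablaCurv G y (e j) (e i) z (e j)) (e i) := fun i j => by
    have h := congrArg (fun v => G y v (e i)) (hG.second_bianchi z (e i) (e j) (e j))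
    simp only [map_add, add_apply, map_zero, zero_apply] at h
    rw [hG.nablaCurv_skew (e i), hG.isScalarProduct.symm (e j), hG.nablaCurv_swap (e j) z,
      map_neg, neg_apply] at h
    linarith
  rw [bianchiOp_apply]
  simp only [fun i => hsymm (e i) (e i) z, hG.nablaBil_ric he, hcyclic, Finset.sum_add_distrib]
  rw [Finset.sum_comm (f := fun i j => G y (nablaCurv G y (e i) (e j) z (e i)) (e j)), zero_apply]
  ring

theorem IsMetricNear.sum_christoffel_ric_sub (hG : IsMetricNear G y)
    (hpos : ∀ᶠ z in 𝓝 y, IsInner (G z)) (hR : IsMetricNear (ric G) y)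
    (he : IsOrthonormal (G y) e) :
    ∑ i, (christoffel (ric G) y (e i) (e i) - christoffel G y (e i) (e i)) = 0 :=
  hR.isScalarProduct.eq_of_forall fun z => by
    rw [hG.sum_christoffel_sub hR, hG.bianchiOp_ric hpos he, map_zero]

theorem IsMetricNear.fderiv_eq_zero_of_york (hG : IsMetricNear G y)
    (hpos : ∀ᶠ z in 𝓝 y, IsInner (G z)) (he : IsOrthonormal (G y) e) (hn : Fintype.card ι ≠ 2)
    {ξ : E → E} (hξ : ContDiffAt ℝ ∞ ξ y) {lam : E → ℝ} (hlam : DifferentiableAt ℝ lam y)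
    {φ : E → Bil E} (hφ : DifferentiableAt ℝ φ y)
    (hYork : ric G =ᶠ[𝓝 y] (1 / 2 : ℝ) • lieBil ξ G + lam • G + φ)
    (hharm : ∑ i, lieConn (christoffel G) ξ y (e i) (e i) = 0)
    (hdiv : ∀ z, ∑ i, nablaBil G φ y (e i) (e i) z = 0)
    (htr : ∀ᶠ z in 𝓝 y, trBil (G z) (φ z) = 0) : fderiv ℝ lam y = 0 := by
  have dG := hG.differentiableAt
  have dL : DifferentiableAt ℝ (lieBil ξ G) y :=
    (contDiffAt_lieBil hξ hG.contDiffAt).differentiableAt (by simp)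
  have hlie : bianchiOp G (lieBil ξ G) y e = 0 := by rw [← hG.sum_lieConn hξ e, hharm, map_zero]
  have hbianchi := hG.bianchiOp_ric hpos he
  rw [bianchiOp_congr hYork, bianchiOp_add ((dL.const_smul _).add (hlam.smul dG)) hφ,
    bianchiOp_add (dL.const_smul _) (hlam.smul dG), bianchiOp_const_smul _ dL, hlie, smul_zero,
    zero_add, hG.bianchiOp_smul_self he hlam, hG.bianchiOp_eq_zero he hφ hdiv htr,
    add_zero] at hbianchi
  refine (smul_eq_zero.1 hbianchi).resolve_left fun h => hn ?_
  exact_mod_cast (by linarith : (Fintype.card ι : ℝ) = 2)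

end Bianchi

section Density

variable {E ι : Type*} [NormedAddCommGroup E] [NormedSpace ℝ E] [Fintype ι] [DecidableEq ι]

theorem differentiable_det [FiniteDimensional ℝ E] :
    Differentiable ℝ fun T : E →L[ℝ] E => T.det := by
  let b := finBasis ℝ E
  have hentry : ∀ i j, Differentiable ℝ fun T : E →L[ℝ] E =>
      LinearMap.toMatrix b b (T : E →ₗ[ℝ] E) i j := fun i j => by
    simp only [LinearMap.toMatrix_apply]
    exact (LinearMap.toContinuousLinearMap (b.coord i)).differentiable.comp
      (ContinuousLinearMap.apply ℝ E (b j)).differentiable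
  have hdet : (fun T : E →L[ℝ] E => T.det) = fun T : E →L[ℝ] E =>
      (LinearMap.toMatrix b b (T : E →ₗ[ℝ] E)).det :=
    funext fun T => (LinearMap.det_toMatrix b (T : E →ₗ[ℝ] E)).symm
  rw [hdet]
  simp only [Matrix.det_apply, Units.smul_def, zsmul_eq_mul]
  fun_prop

theorem hasDerivAt_det_one_add_smul (A : Matrix ι ι ℝ) :
    HasDerivAt (fun t : ℝ => (1 + t • A).det) A.trace 0 := by
  rw [funext fun t : ℝ => Matrix.det_one_add_smul t A]
  set p := (Matrix.det (1 + (Polynomial.X : Polynomial ℝ) • A.map Polynomial.C)).divX.divX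
  have hp : HasDerivAt (fun t : ℝ => p.eval t * t ^ 2) 0 0 := by
    simpa using (p.hasDerivAt 0).fun_mul (hasDerivAt_pow 2 (0 : ℝ))
  simpa using (((hasDerivAt_id (0 : ℝ)).const_mul A.trace).const_add 1).fun_add hp

theorem hasFDerivAt_det_one [FiniteDimensional ℝ E] :
    HasFDerivAt (fun T : E →L[ℝ] E => T.det) (traceL E) 1 := by
  have hdet := (differentiable_det (E := E) 1).hasFDerivAt
  suffices h : fderiv ℝ (fun T : E →L[ℝ] E => T.det) 1 = traceL E by rwa [h] at hdet
  ext T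
  let b := finBasis ℝ E
  have hline : HasDerivAt (fun t : ℝ => 1 + t • T) T 0 := by
    simpa using ((hasDerivAt_id (0 : ℝ)).smul_const T).const_add (1 : E →L[ℝ] E)
  have hcomp : HasDerivAt (fun t : ℝ => (1 + t • T).det)
      (fderiv ℝ (fun T : E →L[ℝ] E => T.det) 1 T) 0 :=
    HasFDerivAt.comp_hasDerivAt (l := fun T : E →L[ℝ] E => T.det) (0 : ℝ)
      (by simpa using hdet) hline
  have hmatrix : ∀ t : ℝ, (1 + t • T).det =
      (1 + t • LinearMap.toMatrix b b (T : E →ₗ[ℝ] E)).det := fun t => by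
    rw [ContinuousLinearMap.det, ← LinearMap.det_toMatrix b, ← LinearMap.toMatrix_one b,
      ← map_smul, ← map_add]
    rfl
  rw [funext hmatrix] at hcomp
  exact (hcomp.unique (hasDerivAt_det_one_add_smul _)).trans
    (LinearMap.trace_eq_matrix_trace ℝ b (T : E →ₗ[ℝ] E)).symm

theorem trBil_leibniz [FiniteDimensional ℝ E] {B : Bil E} (hB : IsInner B) (T : E →L[ℝ] E) :
    trBil B (leibniz B T) = 2 * traceL E T := by
  obtain ⟨e, he⟩ := hB.exists_isOrthonormal
  rw [he.trBil_eq hB.isScalarProduct, he.traceL_eq, Finset.mul_sum]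
  refine Finset.sum_congr rfl fun i _ => ?_
  rw [leibniz_apply, hB.symm (e i)]
  ring

/-- The determinant of the Gram matrix of the bilinear form `B` in the basis `b`. -/
noncomputable def gramDet (b : Basis ι ℝ E) (B : Bil E) : ℝ :=
  (LinearMap.BilinForm.toMatrix b B.toBilinForm).det

variable (b : Basis ι ℝ E)

theorem gramDet_comp (B : Bil E) (T : E →L[ℝ] E) :
    gramDet b (B.comp T) = T.det * gramDet b B := by
  have hT : (B.comp T).toBilinForm = B.toBilinForm.compLeft (T : E →ₗ[ℝ] E) := rfl
  rw [gramDet, hT, LinearMap.BilinForm.toMatrix_compLeft, Matrix.det_mul, Matrix.det_transpose,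
    LinearMap.det_toMatrix]
  rfl

theorem gramDet_bilinearComp (B : Bil E) (T : E →L[ℝ] E) :
    gramDet b (B.bilinearComp T T) = T.det ^ 2 * gramDet b B := by
  have hT : (B.bilinearComp T T).toBilinForm =
      B.toBilinForm.comp (T : E →ₗ[ℝ] E) (T : E →ₗ[ℝ] E) := rfl
  rw [gramDet, hT, LinearMap.BilinForm.toMatrix_comp b b, Matrix.det_mul, Matrix.det_mul,
    Matrix.det_transpose, LinearMap.det_toMatrix, mul_right_comm, ← sq]
  rfl

variable {b}

theorem IsInner.gramDet_pos {B : Bil E} (hB : IsInner B) : 0 < gramDet b B := by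
  refine Matrix.PosDef.det_pos (Matrix.PosDef.of_dotProduct_mulVec_pos ?_ fun x hx => ?_)
  · ext i j
    simp [LinearMap.BilinForm.toMatrix_apply, hB.symm (b j)]
  · rw [star_trivial, LinearMap.BilinForm.dotProduct_toMatrix_mulVec]
    exact hB.pos _ ((LinearEquiv.map_ne_zero_iff _).2 hx)

variable {G : E → Bil E} {y : E}

variable (b) in
/-- The density `√(det (Gᵢⱼ))` of the Riemannian measure of the metric `G`, in the basis `b`. -/
noncomputable def density (G : E → Bil E) (y : E) : ℝ := √(gramDet b (G y))

theorem density_pos (hG : IsInner (G y)) : 0 < density b G y :=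
  Real.sqrt_pos.2 hG.gramDet_pos

theorem contDiffAt_density (hG : ContDiffAt ℝ ∞ G y) (hpos : IsInner (G y)) :
    ContDiffAt ℝ ∞ (density b G) y := by
  refine ContDiffAt.sqrt ?_ hpos.gramDet_pos.ne'
  simp only [gramDet, Matrix.det_apply, Units.smul_def, zsmul_eq_mul,
    LinearMap.BilinForm.toMatrix_apply, ContinuousLinearMap.toBilinForm_apply]
  fun_prop

variable [FiniteDimensional ℝ E]

theorem fderiv_density (hG : DifferentiableAt ℝ G y) (hpos : IsInner (G y)) (a : E) :
    fderiv ℝ (density b G) y a = (1 / 2) * density b G y * trBil (G y) (fderiv ℝ G y a) := by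
  have hone : (G y).inverse.comp (G y) = 1 := by
    ext v
    exact hpos.isScalarProduct.eq_of_forall fun z => hpos.isScalarProduct.inverse_apply _ z
  have hfactor : ∀ z, gramDet b (G z) = ((G y).inverse.comp (G z)).det * gramDet b (G y) := by
    intro z
    rw [← gramDet_comp]
    congr 1
    ext v w
    exact (hpos.isScalarProduct.inverse_apply _ w).symm
  have hcomp : HasFDerivAt (fun z => (G y).inverse.comp (G z))
      ((ContinuousLinearMap.compL ℝ E (E →L[ℝ] ℝ) E (G y).inverse).comp (fderiv ℝ G y)) y :=
    (ContinuousLinearMap.compL ℝ E (E →L[ℝ] ℝ) E (G y).inverse).hasFDerivAt.comp y hG.hasFDerivAt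
  have hdet : HasFDerivAt (fun T : E →L[ℝ] E => T.det) (traceL E) ((G y).inverse.comp (G y)) :=
    hone ▸ hasFDerivAt_det_one
  have hgram : HasFDerivAt (fun z => gramDet b (G z)) _ y :=
    ((hdet.comp y hcomp).mul_const (gramDet b (G y))).congr_of_eventuallyEq
      (Eventually.of_forall hfactor)
  have hsqrt : HasFDerivAt (density b G) _ y := hgram.sqrt hpos.gramDet_pos.ne'
  have hsq : gramDet b (G y) = density b G y * density b G y :=
    (Real.mul_self_sqrt hpos.gramDet_pos.le).symm
  have hne := (density_pos (b := b) hpos).ne'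
  rw [hsqrt.fderiv, ← density, hsq]
  simp only [smul_apply, ContinuousLinearMap.comp_apply, smul_eq_mul, trBil]
  field_simp
  rfl

theorem traceL_fderiv_density_smul (hG : DifferentiableAt ℝ G y) (hpos : IsInner (G y))
    (hρ : DifferentiableAt ℝ (density b G) y) {X : E → E} (hX : DifferentiableAt ℝ X y) :
    traceL E (fderiv ℝ (fun z => density b G z • X z) y) =
      density b G y * ((1 / 2) * trBil (G y) (lieBil X G y)) := by
  have hrank : ∀ (α : E →L[ℝ] ℝ) (v : E), traceL E (α.smulRight v) = α v := fun α v =>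
    LinearMap.trace_smulRight (α : E →ₗ[ℝ] ℝ) v
  have hlie : trBil (G y) (lieBil X G y) =
      trBil (G y) (fderiv ℝ G y (X y)) + 2 * traceL E (fderiv ℝ X y) := by
    rw [← trBil_leibniz hpos]
    simp only [trBil, lieBil, ContinuousLinearMap.comp_add, map_add]
  rw [fderiv_fun_smul hρ hX, map_add, map_smul, hrank, fderiv_density hG hpos, hlie, smul_eq_mul]
  ring

end Density

section Divergence

variable {E F : Type*} [NormedAddCommGroup E] [NormedSpace ℝ E] [MeasurableSpace E] [BorelSpace E]
  [NormedAddCommGroup F] [NormedSpace ℝ F] (μ : Measure E)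

theorem integrable_fderiv_apply [IsFiniteMeasureOnCompacts μ] {f : E → F}
    (hf : ContDiff ℝ 1 f) (hc : HasCompactSupport f) (v : E) :
    Integrable (fun x => fderiv ℝ f x v) μ :=
  ((hf.continuous_fderiv one_ne_zero).clm_apply continuous_const).integrable_of_hasCompactSupport
    (hc.fderiv_apply (𝕜 := ℝ) v)

variable [FiniteDimensional ℝ E] [μ.IsAddHaarMeasure]

theorem integral_fderiv_apply_eq_zero {f : E → F} (hf : ContDiff ℝ 1 f)
    (hc : HasCompactSupport f) (v : E) : ∫ x, fderiv ℝ f x v ∂μ = 0 := by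
  have hparts := integral_smul_fderiv_eq_neg_fderiv_smul_of_integrable (μ := μ) (𝕜 := ℝ)
    (f := fun _ : E => (1 : ℝ)) (g := f) (v := v) (by simp)
    (by simpa using integrable_fderiv_apply μ hf hc v)
    (by simpa using hf.continuous.integrable_of_hasCompactSupport hc)
    (fun _ _ => differentiableAt_const _) (fun x _ => hf.differentiable one_ne_zero x)
  simpa using hparts

theorem integral_traceL_fderiv_eq_zero {V : E → E} (hV : ContDiff ℝ 1 V)
    (hc : HasCompactSupport V) : ∫ y, traceL E (fderiv ℝ V y) ∂μ = 0 := by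
  let b := finBasis ℝ E
  let coord := fun i => LinearMap.toContinuousLinearMap (b.coord i)
  have htrace : ∀ T : E →L[ℝ] E, traceL E T = ∑ i, coord i (T (b i)) := fun T => by
    refine (LinearMap.trace_eq_matrix_trace ℝ b (T : E →ₗ[ℝ] E)).trans ?_
    simp [Matrix.trace, LinearMap.toMatrix_apply, coord]
  have hint := fun i => integrable_fderiv_apply μ hV hc (b i)
  simp only [htrace]
  rw [integral_finsetSum _ fun i _ => (coord i).integrable_comp (hint i)]
  refine Finset.sum_eq_zero fun i _ => ?_
  rw [(coord i).integral_comp_comm (hint i), integral_fderiv_apply_eq_zero μ hV hc, map_zero]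

theorem setIntegral_traceL_fderiv_eq_zero {Ω K : Set E} (hΩ : IsOpen Ω) (hK : IsCompact K)
    (hKΩ : K ⊆ Ω) {W : E → E} (hW : ContDiffOn ℝ 1 W Ω) (hzero : ∀ y ∈ Ω, y ∉ K → W y = 0) :
    ∫ y in Ω, traceL E (fderiv ℝ W y) ∂μ = 0 := by
  set V := Ω.indicator W with hV
  have hV_zero : ∀ y ∉ K, V y = 0 := fun y hy => by
    by_cases hyΩ : y ∈ Ω
    · rw [hV, Set.indicator_of_mem hyΩ, hzero y hyΩ hy]
    · rw [hV, Set.indicator_of_notMem hyΩ]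
  have hVW : ∀ y ∈ Ω, V =ᶠ[𝓝 y] W := fun y hy => by
    filter_upwards [hΩ.mem_nhds hy] with z hz using Set.indicator_of_mem hz W
  have hV_near : ∀ y ∉ K, V =ᶠ[𝓝 y] fun _ => 0 := fun y hy => by
    filter_upwards [hK.isClosed.isOpen_compl.mem_nhds hy] with z hz using hV_zero z hz
  have hV_smooth : ContDiff ℝ 1 V := contDiff_iff_contDiffAt.2 fun y => by
    by_cases hy : y ∈ K
    · exact (hW.contDiffAt (hΩ.mem_nhds (hKΩ hy))).congr_of_eventuallyEq (hVW y (hKΩ hy))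
    · exact contDiffAt_const.congr_of_eventuallyEq (hV_near y hy)
  calc ∫ y in Ω, traceL E (fderiv ℝ W y) ∂μ
      = ∫ y in Ω, traceL E (fderiv ℝ V y) ∂μ :=
        setIntegral_congr_fun hΩ.measurableSet fun y hy => by rw [(hVW y hy).fderiv_eq]
    _ = ∫ y, traceL E (fderiv ℝ V y) ∂μ :=
        setIntegral_eq_integral_of_forall_compl_eq_zero fun y hy => by
          rw [(hV_near y fun h => hy (hKΩ h)).fderiv_eq, fderiv_fun_const, Pi.zero_apply, map_zero]
    _ = 0 := integral_traceL_fderiv_eq_zero μ hV_smooth (HasCompactSupport.intro hK hV_zero)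

end Divergence

end LocalGeom

namespace RiemGeom

open Module Filter Topology LocalGeom VectorField

variable {n : ℕ} {M : Type*} [TopologicalSpace M] [ChartedSpace (EuclideanSpace ℝ (Fin n)) M]

local notation:max "ℝ^" n:max => EuclideanSpace ℝ (Fin n)

/-- The differential of the inverse of the chart at `c`, identifying the model space with the
tangent spaces. -/
noncomputable def chartFrame (c : M) (y : ℝ^n) :
    ℝ^n →L[ℝ] TangentSpace (𝓡 n) ((extChartAt (𝓡 n) c).symm y) :=
  mfderiv 𝓘(ℝ, ℝ^n) (𝓡 n) (extChartAt (𝓡 n) c).symm y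

section Chart

variable {c : M} {y : ℝ^n}

theorem target_mem_nhds (hy : y ∈ (extChartAt (𝓡 n) c).target) :
    (extChartAt (𝓡 n) c).target ∈ 𝓝 y :=
  (isOpen_extChartAt_target (I := 𝓡 n) c).mem_nhds hy

theorem source_mem_nhds (hy : y ∈ (extChartAt (𝓡 n) c).target) :
    (extChartAt (𝓡 n) c).source ∈ 𝓝 ((extChartAt (𝓡 n) c).symm y) :=
  (isOpen_extChartAt_source (I := 𝓡 n) c).mem_nhds ((extChartAt (𝓡 n) c).map_target hy)

theorem tendsto_chart (hy : y ∈ (extChartAt (𝓡 n) c).target) :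
    Tendsto (extChartAt (𝓡 n) c) (𝓝 ((extChartAt (𝓡 n) c).symm y)) (𝓝 y) := by
  have h := (continuousAt_extChartAt' (I := 𝓡 n) ((extChartAt (𝓡 n) c).map_target hy)).tendsto
  rwa [(extChartAt (𝓡 n) c).right_inv hy] at h

theorem tendsto_chart_symm (hy : y ∈ (extChartAt (𝓡 n) c).target) :
    Tendsto (extChartAt (𝓡 n) c).symm (𝓝 y) (𝓝 ((extChartAt (𝓡 n) c).symm y)) :=
  (continuousAt_extChartAt_symm'' (I := 𝓡 n) hy).tendsto

theorem forall_of_chart {P : M → Prop}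
    (h : ∀ c : M, ∀ y ∈ (extChartAt (𝓡 n) c).target, P ((extChartAt (𝓡 n) c).symm y)) (x : M) :
    P x :=
  extChartAt_to_inv (I := 𝓡 n) x ▸ h x _ (mem_extChartAt_target (I := 𝓡 n) x)

variable [IsManifold (𝓡 n) ∞ M]

theorem chartFrame_isInvertible (hy : y ∈ (extChartAt (𝓡 n) c).target) :
    (chartFrame c y).IsInvertible := by
  have h := isInvertible_mfderivWithin_extChartAt_symm (I := 𝓡 n) hy
  rwa [ModelWithCorners.range_eq_univ, mfderivWithin_univ] at h

theorem chartFrame_inverse_apply (hy : y ∈ (extChartAt (𝓡 n) c).target) (v : ℝ^n) :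
    (chartFrame c y).inverse (chartFrame c y v) = v :=
  (chartFrame_isInvertible hy).inverse_apply_self v

theorem chartFrame_apply_inverse (hy : y ∈ (extChartAt (𝓡 n) c).target)
    (v : TangentSpace (𝓡 n) ((extChartAt (𝓡 n) c).symm y)) :
    chartFrame c y ((chartFrame c y).inverse v) = v :=
  (chartFrame_isInvertible hy).self_apply_inverse v

theorem chartFrame_surjective (hy : y ∈ (extChartAt (𝓡 n) c).target) :
    Function.Surjective (chartFrame c y) := fun v => ⟨_, chartFrame_apply_inverse hy v⟩

theorem chartFrame_injective (hy : y ∈ (extChartAt (𝓡 n) c).target) :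
    Function.Injective (chartFrame c y) :=
  Function.LeftInverse.injective (chartFrame_inverse_apply hy)

theorem contMDiffAt_symm (hy : y ∈ (extChartAt (𝓡 n) c).target) :
    ContMDiffAt 𝓘(ℝ, ℝ^n) (𝓡 n) ∞ (extChartAt (𝓡 n) c).symm y :=
  (contMDiffOn_extChartAt_symm c).contMDiffAt (target_mem_nhds hy)

theorem contMDiffAt_chart (hy : y ∈ (extChartAt (𝓡 n) c).target) :
    ContMDiffAt (𝓡 n) 𝓘(ℝ, ℝ^n) ∞ (extChartAt (𝓡 n) c) ((extChartAt (𝓡 n) c).symm y) :=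
  contMDiffOn_extChartAt.contMDiffAt (extChartAt_source (𝓡 n) c ▸ source_mem_nhds hy)

theorem mdifferentiableAt_of_chart {F : Type*} [NormedAddCommGroup F] [NormedSpace ℝ F] {f : M → F}
    (hy : y ∈ (extChartAt (𝓡 n) c).target)
    (hf : DifferentiableAt ℝ (fun z => f ((extChartAt (𝓡 n) c).symm z)) y) :
    MDifferentiableAt (𝓡 n) 𝓘(ℝ, F) f ((extChartAt (𝓡 n) c).symm y) := by
  have h : MDifferentiableAt (𝓡 n) 𝓘(ℝ, F)
      ((fun z => f ((extChartAt (𝓡 n) c).symm z)) ∘ extChartAt (𝓡 n) c)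
      ((extChartAt (𝓡 n) c).symm y) := by
    refine MDifferentiableAt.comp (I' := 𝓘(ℝ, ℝ^n)) _ ?_
      ((contMDiffAt_chart hy).mdifferentiableAt (by simp))
    rw [(extChartAt (𝓡 n) c).right_inv hy]
    exact hf.mdifferentiableAt
  refine h.congr_of_eventuallyEq ?_
  filter_upwards [source_mem_nhds hy] with x hx
  rw [Function.comp_apply, (extChartAt (𝓡 n) c).left_inv hx]

theorem dirDeriv_chartFrame {f : M → ℝ} (hy : y ∈ (extChartAt (𝓡 n) c).target)
    (hf : DifferentiableAt ℝ (fun z => f ((extChartAt (𝓡 n) c).symm z)) y) (a : ℝ^n) :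
    dirDeriv f ((extChartAt (𝓡 n) c).symm y) (chartFrame c y a) =
      fderiv ℝ (fun z => f ((extChartAt (𝓡 n) c).symm z)) y a := by
  have hcomp := mfderiv_comp y (mdifferentiableAt_of_chart hy hf)
    ((contMDiffAt_symm hy).mdifferentiableAt (by simp))
  rw [← mfderiv_eq_fderiv]
  exact (congrArg (fun T => T a) hcomp).symm

theorem mpullback_chart {V : Π z : ℝ^n, TangentSpace 𝓘(ℝ, ℝ^n) z}
    (hy : y ∈ (extChartAt (𝓡 n) c).target) :
    mpullback (𝓡 n) 𝓘(ℝ, ℝ^n) (extChartAt (𝓡 n) c) V ((extChartAt (𝓡 n) c).symm y) =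
      chartFrame c y (V y) := by
  rw [mpullback_apply,
    (isInvertible_mfderiv_extChartAt ((extChartAt (𝓡 n) c).map_target hy)).inverse_apply_eq]
  have hcomp := mfderiv_extChartAt_comp_mfderivWithin_extChartAt_symm (I := 𝓡 n) hy
  rw [ModelWithCorners.range_eq_univ, mfderivWithin_univ] at hcomp
  refine Eq.trans ?_ (congrArg (fun T => T (V y)) hcomp).symm
  rw [(extChartAt (𝓡 n) c).right_inv hy]
  rfl

theorem contMDiffAt_mpullback_chart {V : ℝ^n → ℝ^n} (hy : y ∈ (extChartAt (𝓡 n) c).target)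
    (hV : ContDiffAt ℝ ∞ V y) :
    ContMDiffAt (𝓡 n) (𝓡 n).tangent ∞ (fun x => TotalSpace.mk' ℝ^n x
      (mpullback (𝓡 n) 𝓘(ℝ, ℝ^n) (extChartAt (𝓡 n) c) V x)) ((extChartAt (𝓡 n) c).symm y) := by
  refine ContMDiffAt.mpullback_vectorField_preimage (n := ∞) ?_ (contMDiffAt_chart hy)
    (isInvertible_mfderiv_extChartAt ((extChartAt (𝓡 n) c).map_target hy)) (by simp)
  rw [(extChartAt (𝓡 n) c).right_inv hy]
  exact contMDiffAt_vectorSpace_iff_contDiffAt.2 hV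

end Chart

/-- The vector field `X` is smooth near the point with coordinates `y` in the chart at `c`, and
has the coordinate expression `V` there. -/
def HasCoordExpr (c : M) (X : VField n M) (V : ℝ^n → ℝ^n) (y : ℝ^n) : Prop :=
  ∀ᶠ z in 𝓝 y, z ∈ (extChartAt (𝓡 n) c).target ∧ ContDiffAt ℝ ∞ V z ∧
    X ((extChartAt (𝓡 n) c).symm z) = chartFrame c z (V z)

namespace HasCoordExpr

variable {c : M} {X Y : VField n M} {V W : ℝ^n → ℝ^n} {y : ℝ^n}

theorem eventually (h : HasCoordExpr c X V y) : ∀ᶠ z in 𝓝 y, HasCoordExpr c X V z :=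
  eventually_eventually_nhds.2 h

theorem mem_target (h : HasCoordExpr c X V y) : y ∈ (extChartAt (𝓡 n) c).target :=
  h.self_of_nhds.1

theorem contDiffAt (h : HasCoordExpr c X V y) : ContDiffAt ℝ ∞ V y :=
  h.self_of_nhds.2.1

theorem eq (h : HasCoordExpr c X V y) :
    X ((extChartAt (𝓡 n) c).symm y) = chartFrame c y (V y) :=
  h.self_of_nhds.2.2

theorem differentiableAt (h : HasCoordExpr c X V y) : DifferentiableAt ℝ V y :=
  h.contDiffAt.differentiableAt (by simp)

theorem differentiableAt_fderiv (h : HasCoordExpr c X V y) : DifferentiableAt ℝ (fderiv ℝ V) y :=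
  (contDiffAt_fderiv h.contDiffAt).differentiableAt (by simp)

variable [IsManifold (𝓡 n) ∞ M]

theorem contMDiffAt (h : HasCoordExpr c X V y) :
    ContMDiffAt (𝓡 n) (𝓡 n).tangent ∞ (fun x => TotalSpace.mk' ℝ^n x (X x))
      ((extChartAt (𝓡 n) c).symm y) := by
  refine (contMDiffAt_mpullback_chart h.mem_target h.contDiffAt).congr_of_eventuallyEq ?_
  filter_upwards [(tendsto_chart h.mem_target).eventually h.eventually,
    source_mem_nhds h.mem_target] with x hx hxs
  have hXx : X x = mpullback (𝓡 n) 𝓘(ℝ, ℝ^n) (extChartAt (𝓡 n) c) V x := by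
    rw [← (extChartAt (𝓡 n) c).left_inv hxs]
    exact hx.eq.trans (mpullback_chart hx.mem_target).symm
  rw [hXx]

theorem mdifferentiableAt (h : HasCoordExpr c X V y) :
    MDifferentiableAt (𝓡 n) (𝓡 n).tangent (fun x => TotalSpace.mk' ℝ^n x (X x))
      ((extChartAt (𝓡 n) c).symm y) :=
  h.contMDiffAt.mdifferentiableAt (by simp)

theorem mpullback_eventuallyEq (h : HasCoordExpr c X V y) :
    mpullback 𝓘(ℝ, ℝ^n) (𝓡 n) (extChartAt (𝓡 n) c).symm X =ᶠ[𝓝 y] V := by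
  filter_upwards [h] with z ⟨hz, _, hXz⟩
  rw [mpullback_apply, hXz]
  exact chartFrame_inverse_apply hz _

theorem bracket_eq (hX : HasCoordExpr c X V y) (hY : HasCoordExpr c Y W y) :
    RiemGeom.bracket X Y ((extChartAt (𝓡 n) c).symm y) =
      chartFrame c y (fderiv ℝ W y (V y) - fderiv ℝ V y (W y)) := by
  have hle : minSmoothness ℝ 2 ≤ (∞ : WithTop ℕ∞) := by
    rw [minSmoothness_of_isRCLikeNormedField]
    exact ENat.LEInfty.out
  have : IsManifold (𝓡 n) (minSmoothness ℝ 2) M := IsManifold.of_le hle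
  have hpull := mpullback_mlieBracket hX.mdifferentiableAt hY.mdifferentiableAt
    (contMDiffAt_symm hX.mem_target) hle
  rw [hX.mpullback_eventuallyEq.mlieBracket_vectorField_eq hY.mpullback_eventuallyEq] at hpull
  have hflat := congrFun (mlieBracketWithin_eq_lieBracketWithin (𝕜 := ℝ) (V := V) (W := W)
    (s := Set.univ)) y
  rw [lieBracketWithin_univ] at hflat
  have hinv : (chartFrame c y).inverse (RiemGeom.bracket X Y ((extChartAt (𝓡 n) c).symm y)) =
      fderiv ℝ W y (V y) - fderiv ℝ V y (W y) := hpull.trans hflat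
  rw [← hinv, chartFrame_apply_inverse hX.mem_target]

theorem bracket (hX : HasCoordExpr c X V y) (hY : HasCoordExpr c Y W y) :
    HasCoordExpr c (RiemGeom.bracket X Y) (fun z => fderiv ℝ W z (V z) - fderiv ℝ V z (W z)) y := by
  filter_upwards [hX.eventually, hY.eventually] with z hXz hYz
  exact ⟨hXz.mem_target,
    ((contDiffAt_fderiv hYz.contDiffAt).clm_apply hXz.contDiffAt).sub
      ((contDiffAt_fderiv hXz.contDiffAt).clm_apply hYz.contDiffAt), hXz.bracket_eq hYz⟩

end HasCoordExpr

/-- The coordinate expression of the vector field `X` in the chart at `c`. -/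
noncomputable def chartVField (c : M) (X : VField n M) (y : ℝ^n) : ℝ^n :=
  (chartFrame c y).inverse (X ((extChartAt (𝓡 n) c).symm y))

section VectorField

variable [IsManifold (𝓡 n) ∞ M] {c : M} {y : ℝ^n}

theorem hasCoordExpr_chartVField {X : VField n M} (hy : y ∈ (extChartAt (𝓡 n) c).target)
    (hX : ∀ᶠ x in 𝓝 ((extChartAt (𝓡 n) c).symm y),
      ContMDiffAt (𝓡 n) (𝓡 n).tangent ∞ (fun x => TotalSpace.mk' ℝ^n x (X x)) x) :
    HasCoordExpr c X (chartVField c X) y := by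
  filter_upwards [target_mem_nhds hy, (tendsto_chart_symm hy).eventually hX] with z hz hXz
  refine ⟨hz, contMDiffAt_vectorSpace_iff_contDiffAt.1 ?_, (chartFrame_apply_inverse hz _).symm⟩
  exact ContMDiffAt.mpullback_vectorField_preimage (n := ∞) hXz (contMDiffAt_symm hz)
    (chartFrame_isInvertible hz) (by simp)

theorem exists_hasCoordExpr_ext (hy : y ∈ (extChartAt (𝓡 n) c).target) (a : ℝ^n) :
    ∃ V : ℝ^n → ℝ^n, HasCoordExpr c (ext (chartFrame c y a)) V y ∧ V y = a := by
  obtain ⟨s, hs, hsmooth⟩ := FiberBundle.exists_contMDiffOn_extend (k := ∞) (𝓡 n) ℝ^n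
    (V := fun x : M => TangentSpace (𝓡 n) x) (chartFrame c y a)
  have hV : HasCoordExpr c (ext (chartFrame c y a)) (chartVField c (ext (chartFrame c y a))) y :=
    hasCoordExpr_chartVField hy <| by
      filter_upwards [eventually_mem_nhds_iff.2 hs] with x hx
      exact hsmooth.contMDiffAt hx
  refine ⟨_, hV, chartFrame_injective hy ?_⟩
  rw [← hV.eq]
  exact FiberBundle.extend_apply_self _ _

end VectorField

section Tensor

/-- The two-tensor `h` has the coordinate expression `H` in the chart at `c`. -/
def HasTensorExpr (c : M) (h : Tensor2 n M) (H : ℝ^n → Bil ℝ^n) : Prop :=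
  ∀ y ∈ (extChartAt (𝓡 n) c).target, ∀ a b,
    h ((extChartAt (𝓡 n) c).symm y) (chartFrame c y a) (chartFrame c y b) = H y a b

variable {c : M} {y : ℝ^n} {h k : Tensor2 n M} {H K : ℝ^n → Bil ℝ^n} {X Y Z : VField n M}
  {V W U : ℝ^n → ℝ^n}

theorem HasCoordExpr.fderiv_bracket (hX : HasCoordExpr c X V y)
    (hY : HasCoordExpr c Y W y) (a : ℝ^n) :
    fderiv ℝ (fun z => fderiv ℝ W z (V z) - fderiv ℝ V z (W z)) y a =
      fderiv ℝ (fderiv ℝ W) y a (V y) + fderiv ℝ W y (fderiv ℝ V y a)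
      - (fderiv ℝ (fderiv ℝ V) y a (W y) + fderiv ℝ V y (fderiv ℝ W y a)) := by
  have dV := hX.differentiableAt
  have dW := hY.differentiableAt
  have ddV := hX.differentiableAt_fderiv
  have ddW := hY.differentiableAt_fderiv
  rw [fderiv_fun_sub (by fun_prop) (by fun_prop), sub_apply, fderiv_apply₁ ddW dV,
    fderiv_apply₁ ddV dW]

theorem HasCoordExpr.fderiv_connection (hX : HasCoordExpr c X V y)
    (hY : HasCoordExpr c Y W y) (hH : IsMetricNear H y) (a : ℝ^n) :
    fderiv ℝ (fun z => fderiv ℝ W z (V z) + christoffel H z (V z) (W z)) y a =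
      fderiv ℝ (fderiv ℝ W) y a (V y) + fderiv ℝ W y (fderiv ℝ V y a)
      + (fderiv ℝ (christoffel H) y a (V y) (W y) + christoffel H y (fderiv ℝ V y a) (W y)
        + christoffel H y (V y) (fderiv ℝ W y a)) := by
  have dV := hX.differentiableAt
  have dW := hY.differentiableAt
  have ddW := hY.differentiableAt_fderiv
  have dΓ := hH.differentiableAt_christoffel
  rw [fderiv_fun_add (by fun_prop) (by fun_prop), add_apply, fderiv_apply₁ ddW dV,
    fderiv_apply₂ dΓ dV dW]

variable [IsManifold (𝓡 n) ∞ M]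

namespace HasTensorExpr

theorem dualVec_eq (hh : HasTensorExpr c h H) (hy : y ∈ (extChartAt (𝓡 n) c).target)
    (hH : IsScalarProduct (H y)) {α : TangentSpace (𝓡 n) ((extChartAt (𝓡 n) c).symm y) → ℝ}
    {w : ℝ^n} (hw : ∀ b, H y w b = α (chartFrame c y b)) :
    dualVec h ((extChartAt (𝓡 n) c).symm y) α = chartFrame c y w := by
  have hex : ∃ w' : TangentSpace (𝓡 n) ((extChartAt (𝓡 n) c).symm y),
      ∀ v, h ((extChartAt (𝓡 n) c).symm y) w' v = α v := by
    refine ⟨chartFrame c y w, fun v => ?_⟩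
    obtain ⟨b, rfl⟩ := chartFrame_surjective hy v
    rw [hh y hy, hw]
  obtain ⟨w', hw'⟩ := chartFrame_surjective hy (dualVec h ((extChartAt (𝓡 n) c).symm y) α)
  rw [← hw']
  congr 1
  refine hH.eq_of_forall fun b => ?_
  rw [hw, ← hh y hy, hw']
  exact Classical.epsilon_spec hex _

theorem dirDeriv_eq (hk : HasTensorExpr c k K) (hK : DifferentiableAt ℝ K y)
    (hY : HasCoordExpr c Y W y) (hZ : HasCoordExpr c Z V y) (a : ℝ^n) :
    dirDeriv (fun x => k x (Y x) (Z x)) ((extChartAt (𝓡 n) c).symm y) (chartFrame c y a) =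
      fderiv ℝ K y a (W y) (V y) + K y (fderiv ℝ W y a) (V y) + K y (W y) (fderiv ℝ V y a) := by
  have hcoord : (fun z => k ((extChartAt (𝓡 n) c).symm z) (Y ((extChartAt (𝓡 n) c).symm z))
      (Z ((extChartAt (𝓡 n) c).symm z))) =ᶠ[𝓝 y] fun z => K z (W z) (V z) := by
    filter_upwards [hY.eventually, hZ.eventually] with z hYz hZz
    rw [hYz.eq, hZz.eq, hk z hYz.mem_target]
  rw [dirDeriv_chartFrame hY.mem_target, hcoord.fderiv_eq,
    fderiv_apply₂ hK hY.differentiableAt hZ.differentiableAt]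
  exact ((hK.clm_apply hY.differentiableAt).clm_apply hZ.differentiableAt).congr_of_eventuallyEq
    hcoord

theorem leviCivita_eq (hh : HasTensorExpr c h H) (hH : IsMetricNear H y)
    (hX : HasCoordExpr c X V y) (hY : HasCoordExpr c Y W y) :
    leviCivita h X Y ((extChartAt (𝓡 n) c).symm y) =
      chartFrame c y (fderiv ℝ W y (V y) + christoffel H y (V y) (W y)) := by
  have hy := hX.mem_target
  refine hh.dualVec_eq hy hH.isScalarProduct fun b => ?_
  obtain ⟨Z, hZ, hZy⟩ := exists_hasCoordExpr_ext hy b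
  have hs := hH.isScalarProduct.symm
  have dH := hH.differentiableAt
  rw [koszul, hX.eq, hY.eq, hZ.eq, hh.dirDeriv_eq dH hY hZ, hh.dirDeriv_eq dH hX hZ,
    hh.dirDeriv_eq dH hX hY, hX.bracket_eq hY, hX.bracket_eq hZ, hY.bracket_eq hZ,
    hh y hy, hh y hy, hh y hy, map_add, add_apply, hH.christoffel_spec, koszulForm_apply, hZy]
  simp only [map_sub, sub_apply]
  rw [hs (fderiv ℝ W y b), hs (fderiv ℝ Z y (W y)), hs (fderiv ℝ Z y (V y))]
  ring

theorem leviCivita (hh : HasTensorExpr c h H) (hH : IsMetricNear H y)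
    (hX : HasCoordExpr c X V y) (hY : HasCoordExpr c Y W y) :
    HasCoordExpr c (RiemGeom.leviCivita h X Y)
      (fun z => fderiv ℝ W z (V z) + christoffel H z (V z) (W z)) y := by
  filter_upwards [hH.eventually, hX.eventually, hY.eventually] with z hHz hXz hYz
  exact ⟨hXz.mem_target,
    ((contDiffAt_fderiv hYz.contDiffAt).clm_apply hXz.contDiffAt).add
      ((hHz.contDiffAt_christoffel.clm_apply hXz.contDiffAt).clm_apply hYz.contDiffAt),
    hh.leviCivita_eq hHz hXz hYz⟩

theorem curvature_eq (hh : HasTensorExpr c h H) (hH : IsMetricNear H y)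
    (hX : HasCoordExpr c X V y) (hY : HasCoordExpr c Y W y) (hZ : HasCoordExpr c Z U y) :
    curvature h X Y Z ((extChartAt (𝓡 n) c).symm y) =
      chartFrame c y (curv H y (V y) (W y) (U y)) := by
  rw [curvature, Pi.sub_apply, Pi.sub_apply, hh.leviCivita_eq hH hX (hh.leviCivita hH hY hZ),
    hh.leviCivita_eq hH hY (hh.leviCivita hH hX hZ), hh.leviCivita_eq hH (hX.bracket hY) hZ,
    ← map_sub, ← map_sub, hY.fderiv_connection hZ hH,
    hX.fderiv_connection hZ hH]
  congr 1
  simp only [curv_apply, map_add, map_sub, sub_apply,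
    fderiv_fderiv_comm hZ.contDiffAt (V y) (W y)]
  abel

theorem covDeriv_eq (hh : HasTensorExpr c h H) (hH : IsMetricNear H y) (hk : HasTensorExpr c k K)
    (hy : y ∈ (extChartAt (𝓡 n) c).target) (hK : DifferentiableAt ℝ K y) (u v w : ℝ^n) :
    covDeriv h k ((extChartAt (𝓡 n) c).symm y) (chartFrame c y u) (chartFrame c y v)
      (chartFrame c y w) = nablaBil H K y u v w := by
  obtain ⟨U, hU, hUy⟩ := exists_hasCoordExpr_ext hy u
  obtain ⟨V, hV, hVy⟩ := exists_hasCoordExpr_ext hy v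
  obtain ⟨W, hW, hWy⟩ := exists_hasCoordExpr_ext hy w
  rw [covDeriv, hk.dirDeriv_eq hK hV hW, hh.leviCivita_eq hH hU hV, hh.leviCivita_eq hH hU hW,
    hk y hy, hk y hy, nablaBil_apply, hUy, hVy, hWy]
  simp only [map_add, add_apply]
  ring

theorem lieDeriv_eq (hk : HasTensorExpr c k K) (hK : DifferentiableAt ℝ K y)
    (hX : HasCoordExpr c X V y) (v w : ℝ^n) :
    lieDeriv X k ((extChartAt (𝓡 n) c).symm y) (chartFrame c y v) (chartFrame c y w) =
      lieBil V K y v w := by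
  have hy := hX.mem_target
  obtain ⟨S, hS, hSy⟩ := exists_hasCoordExpr_ext hy v
  obtain ⟨T, hT, hTy⟩ := exists_hasCoordExpr_ext hy w
  rw [lieDeriv, hX.eq, hk.dirDeriv_eq hK hS hT, hX.bracket_eq hS, hX.bracket_eq hT, hk y hy,
    hk y hy, hSy, hTy]
  simp only [lieBil, add_apply, leibniz_apply, map_sub, sub_apply]
  ring

theorem lieDerivConnection_eq (hh : HasTensorExpr c h H) (hH : IsMetricNear H y)
    (hX : HasCoordExpr c X V y) (v w : ℝ^n) :
    lieDerivConnection h X ((extChartAt (𝓡 n) c).symm y) (chartFrame c y v) (chartFrame c y w) =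
      chartFrame c y (lieConn (christoffel H) V y v w) := by
  obtain ⟨S, hS, hSy⟩ := exists_hasCoordExpr_ext hX.mem_target v
  obtain ⟨T, hT, hTy⟩ := exists_hasCoordExpr_ext hX.mem_target w
  rw [lieDerivConnection, hX.bracket_eq (hh.leviCivita hH hS hT),
    hh.leviCivita_eq hH (hX.bracket hS) hT, hh.leviCivita_eq hH hS (hX.bracket hT),
    ← map_sub, ← map_sub, hS.fderiv_connection hT hH,
    hX.fderiv_bracket hT]
  congr 1
  simp only [lieConn, map_add, map_sub, sub_apply, fderiv_fderiv_comm hT.contDiffAt (V y) v,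
    hSy, hTy]
  abel

theorem secondFundamentalFormId_eq (hh : HasTensorExpr c h H) (hH : IsMetricNear H y)
    (hk : HasTensorExpr c k K) (hK : IsMetricNear K y) (hy : y ∈ (extChartAt (𝓡 n) c).target)
    (v w : ℝ^n) :
    secondFundamentalFormId h k ((extChartAt (𝓡 n) c).symm y) (chartFrame c y v)
        (chartFrame c y w) =
      chartFrame c y (christoffel K y v w - christoffel H y v w) := by
  obtain ⟨S, hS, hSy⟩ := exists_hasCoordExpr_ext hy v
  obtain ⟨T, hT, hTy⟩ := exists_hasCoordExpr_ext hy w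
  rw [secondFundamentalFormId, hk.leviCivita_eq hK hS hT, hh.leviCivita_eq hH hS hT, ← map_sub,
    hSy, hTy, add_sub_add_left_eq_sub]

end HasTensorExpr

end Tensor

/-- The coordinate expression of a field of bilinear forms in the chart at `c`. -/
noncomputable def chartBil (c : M) (φ : BilinForm n M) (y : ℝ^n) : Bil ℝ^n :=
  ContinuousLinearMap.bilinearComp (E := ℝ^n) (F := ℝ^n) (φ ((extChartAt (𝓡 n) c).symm y))
    (chartFrame c y) (chartFrame c y)

/-- The coordinate expression of a one-form in the chart at `c`. -/
noncomputable def chartForm (c : M) (θ : OneForm n M) (y : ℝ^n) : ℝ^n →L[ℝ] ℝ :=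
  (θ ((extChartAt (𝓡 n) c).symm y)).comp (chartFrame c y)

theorem hasTensorExpr_chartBil (c : M) (φ : BilinForm n M) :
    HasTensorExpr c φ.toTensor2 (chartBil c φ) := fun _ _ _ _ => rfl

section Metric

variable [IsManifold (𝓡 n) ∞ M] {c : M} {y : ℝ^n}

theorem contMDiffOn_chartFrame (c : M) (a : ℝ^n) :
    ContMDiffOn 𝓘(ℝ, ℝ^n) (𝓡 n).tangent ∞
      (fun z => TotalSpace.mk' ℝ^n (E := fun x : M => TangentSpace (𝓡 n) x)
        ((extChartAt (𝓡 n) c).symm z) (chartFrame c z a)) (extChartAt (𝓡 n) c).target := by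
  intro y hy
  have h :=
    (contMDiffAt_mpullback_chart hy (contDiffAt_const (c := a))).comp y (contMDiffAt_symm hy)
  refine (h.congr_of_eventuallyEq ?_).contMDiffWithinAt
  filter_upwards [target_mem_nhds hy] with z hz
  exact congrArg (TotalSpace.mk' ℝ^n _) (mpullback_chart (V := fun _ => a) hz).symm

theorem contDiffOn_chartForm (c : M) {θ : OneForm n M} (hθ : IsSmoothOneForm θ) :
    ContDiffOn ℝ ∞ (chartForm c θ) (extChartAt (𝓡 n) c).target := by
  refine contDiffOn_clm_apply.2 fun a => ?_
  rw [← contMDiffOn_iff_contDiffOn]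
  intro z hz
  have h := ContMDiffOn.clm_bundle_apply (M := ℝ^n) (IM := 𝓘(ℝ, ℝ^n)) (F₂ := ℝ) (E₂ := Trivial M ℝ)
    (b := (extChartAt (𝓡 n) c).symm) (ϕ := fun z => θ ((extChartAt (𝓡 n) c).symm z))
    (hθ.comp_contMDiffOn (contMDiffOn_extChartAt_symm c)) (contMDiffOn_chartFrame c a) z hz
  exact (contMDiffWithinAt_totalSpace.1 h).2

theorem contDiffOn_chartBil (c : M) {φ : BilinForm n M} (hφ : IsSmoothBilinForm φ) :
    ContDiffOn ℝ ∞ (chartBil c φ) (extChartAt (𝓡 n) c).target := by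
  refine contDiffOn_clm_apply.2 fun a => contDiffOn_clm_apply.2 fun b => ?_
  rw [← contMDiffOn_iff_contDiffOn]
  intro z hz
  have h := ContMDiffOn.clm_bundle_apply₂ (M := ℝ^n) (IM := 𝓘(ℝ, ℝ^n)) (F₃ := ℝ)
    (E₃ := Trivial M ℝ) (b := (extChartAt (𝓡 n) c).symm)
    (ψ := fun z => φ ((extChartAt (𝓡 n) c).symm z))
    (hφ.comp_contMDiffOn (contMDiffOn_extChartAt_symm c)) (contMDiffOn_chartFrame c a)
    (contMDiffOn_chartFrame c b) z hz
  exact (contMDiffWithinAt_totalSpace.1 h).2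

theorem contDiffAt_chartBil {φ : BilinForm n M} (hφ : IsSmoothBilinForm φ)
    (hy : y ∈ (extChartAt (𝓡 n) c).target) : ContDiffAt ℝ ∞ (chartBil c φ) y :=
  (contDiffOn_chartBil c hφ).contDiffAt (target_mem_nhds hy)

theorem contDiffAt_comp_chart_symm {f : M → ℝ} (hf : ContMDiff (𝓡 n) 𝓘(ℝ, ℝ) ∞ f)
    (hy : y ∈ (extChartAt (𝓡 n) c).target) :
    ContDiffAt ℝ ∞ (fun z => f ((extChartAt (𝓡 n) c).symm z)) y :=
  contMDiffAt_iff_contDiffAt.1 (hf.contMDiffAt.comp y (contMDiffAt_symm hy))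

/-- The coordinate expression of a Riemannian metric in the chart at `c`. -/
noncomputable def chartMetric (g : Metric n M) (c : M) : ℝ^n → Bil ℝ^n := chartBil c g.inner

theorem hasTensorExpr_chartMetric (g : Metric n M) (c : M) :
    HasTensorExpr c g.tensor (chartMetric g c) := fun _ _ _ _ => rfl

theorem isInner_chartMetric (g : Metric n M) (hy : y ∈ (extChartAt (𝓡 n) c).target) :
    IsInner (chartMetric g c y) where
  symm v w := g.symm _ (chartFrame c y v) (chartFrame c y w)
  pos v hv := g.pos _ (chartFrame c y v) fun h0 =>
    hv (chartFrame_injective hy (h0.trans (map_zero (chartFrame c y)).symm))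

theorem eventually_isInner_chartMetric (g : Metric n M) (hy : y ∈ (extChartAt (𝓡 n) c).target) :
    ∀ᶠ z in 𝓝 y, IsInner (chartMetric g c z) :=
  eventually_of_mem (target_mem_nhds hy) fun _ => isInner_chartMetric g

theorem isMetricNear_chartMetric (g : Metric n M) (hy : y ∈ (extChartAt (𝓡 n) c).target) :
    IsMetricNear (chartMetric g c) y := by
  filter_upwards [target_mem_nhds hy] with z hz
  exact ⟨contDiffAt_chartBil g.contMDiff hz, (isInner_chartMetric g hz).isScalarProduct⟩

/-- The coordinate expression of the vector field dual to a one-form in the chart at `c`. -/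
noncomputable def chartSharp (g : Metric n M) (θ : OneForm n M) (c : M) (y : ℝ^n) : ℝ^n :=
  (chartMetric g c y).inverse (chartForm c θ y)

theorem hasCoordExpr_sharp (g : Metric n M) {θ : OneForm n M} (hθ : IsSmoothOneForm θ)
    (hy : y ∈ (extChartAt (𝓡 n) c).target) :
    HasCoordExpr c (sharp g.tensor θ) (chartSharp g θ c) y := by
  filter_upwards [target_mem_nhds hy] with z hz
  have hs := (isInner_chartMetric g hz).isScalarProduct
  exact ⟨hz, (isMetricNear_chartMetric g hz).contDiffAt_inverse.clm_apply
      ((contDiffOn_chartForm c hθ).contDiffAt (target_mem_nhds hz)),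
    (hasTensorExpr_chartMetric g c).dualVec_eq hz hs fun _ => hs.inverse_apply _ _⟩

theorem exists_isOrthonormal_orthoFrame (g : Metric n M) (hy : y ∈ (extChartAt (𝓡 n) c).target) :
    ∃ e : Basis (Fin n) ℝ ℝ^n, IsOrthonormal (chartMetric g c y) e ∧
      ∀ i, orthoFrame g.tensor ((extChartAt (𝓡 n) c).symm y) i = chartFrame c y (e i) := by
  have hg := hasTensorExpr_chartMetric g c y hy
  have hframe : IsOrthonormalFrame g.tensor ((extChartAt (𝓡 n) c).symm y)
      (orthoFrame g.tensor ((extChartAt (𝓡 n) c).symm y)) := by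
    obtain ⟨e₀, he₀⟩ := (isInner_chartMetric g hy).exists_isOrthonormal
    refine Classical.epsilon_spec ⟨fun i => chartFrame c y
      (e₀.reindex (finCongr finrank_euclideanSpace_fin) i), fun i j => ?_⟩
    rw [hg, Basis.reindex_apply, Basis.reindex_apply, he₀]
    simp only [EmbeddingLike.apply_eq_iff_eq]
  choose v hv using fun i =>
    chartFrame_surjective hy (orthoFrame g.tensor ((extChartAt (𝓡 n) c).symm y) i)
  obtain ⟨e, he, rfl⟩ := exists_basis_of_orthonormal_family (B := chartMetric g c y) (v := v)
    (fun i j => by rw [← hg, hv, hv, hframe i j]) (by simp)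
  exact ⟨e, he, fun i => (hv i).symm⟩

theorem traceAt_eq (g : Metric n M) (hy : y ∈ (extChartAt (𝓡 n) c).target)
    {B : TangentSpace (𝓡 n) ((extChartAt (𝓡 n) c).symm y) →
      TangentSpace (𝓡 n) ((extChartAt (𝓡 n) c).symm y) → ℝ} {K : Bil ℝ^n}
    (hB : ∀ a b, B (chartFrame c y a) (chartFrame c y b) = K a b) :
    traceAt g.tensor ((extChartAt (𝓡 n) c).symm y) B = trBil (chartMetric g c y) K := by
  obtain ⟨e, he, hf⟩ := exists_isOrthonormal_orthoFrame g hy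
  rw [he.trBil_eq (isInner_chartMetric g hy).isScalarProduct, traceAt]
  exact Finset.sum_congr rfl fun i _ => by rw [hf, hB]

theorem hasTensorExpr_ricci (g : Metric n M) (c : M) :
    HasTensorExpr c (ricci g.tensor) (ric (chartMetric g c)) := by
  intro y hy a b
  obtain ⟨e, he, hf⟩ := exists_isOrthonormal_orthoFrame g hy
  obtain ⟨A, hA, hAy⟩ := exists_hasCoordExpr_ext hy a
  obtain ⟨B, hB, hBy⟩ := exists_hasCoordExpr_ext hy b
  rw [he.ric_eq, ricci, traceAt]
  refine Finset.sum_congr rfl fun i _ => ?_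
  obtain ⟨U, hU, hUy⟩ := exists_hasCoordExpr_ext hy (e i)
  rw [hf, (hasTensorExpr_chartMetric g c).curvature_eq (isMetricNear_chartMetric g hy) hU hA hB,
    hasTensorExpr_chartMetric g c y hy, hUy, hAy, hBy]

theorem isHarmonicId_ricci (g : Metric n M)
    (hnd : ∀ (x : M) (v : TangentSpace (𝓡 n) x), (∀ w, ricci g.tensor x v w = 0) → v = 0) :
    IsHarmonicId g.tensor (ricci g.tensor) := by
  refine forall_of_chart (n := n) fun c y hy => ?_
  have hG := isMetricNear_chartMetric g hy
  have hR : IsMetricNear (ric (chartMetric g c)) y := by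
    filter_upwards [target_mem_nhds hy] with z hz
    refine ⟨(isMetricNear_chartMetric g hz).contDiffAt_ric,
      (isMetricNear_chartMetric g hz).ric_symm (isInner_chartMetric g hz), fun v hv => ?_⟩
    refine chartFrame_injective hz (.trans (hnd _ _ fun w => ?_) (map_zero (chartFrame c z)).symm)
    obtain ⟨b, rfl⟩ := chartFrame_surjective hz w
    rw [hasTensorExpr_ricci g c z hz, hv]
  obtain ⟨e, he, hf⟩ := exists_isOrthonormal_orthoFrame g hy
  rw [traceAt, ← map_zero (chartFrame c y),
    ← hG.sum_christoffel_ric_sub (eventually_isInner_chartMetric g hy) hR he, map_sum]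
  refine Finset.sum_congr rfl fun i _ => ?_
  rw [hf, (hasTensorExpr_chartMetric g c).secondFundamentalFormId_eq hG
    (hasTensorExpr_ricci g c) hR hy]

end Metric

section York

variable [IsManifold (𝓡 n) ∞ M] {c : M} {y : ℝ^n}

/-- A York decomposition `Ric = (δ^* θ + λ g) + φ`, with `φ` a TT-tensor, of the Ricci tensor
of `g`. -/
structure IsYorkDecomposition (g : Metric n M) (θ : OneForm n M) (lam : M → ℝ)
    (φ : BilinForm n M) : Prop where
  smooth_form : IsSmoothOneForm θ
  smooth_lam : ContMDiff (𝓡 n) 𝓘(ℝ, ℝ) ∞ lam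
  tt : IsTT g.tensor φ
  eq : ∀ (x : M) (v w : TangentSpace (𝓡 n) x), ricci g.tensor x v w =
    (deltaStar g.tensor θ x v w + lam x * g.tensor x v w) + φ x v w

namespace IsYorkDecomposition

variable {g : Metric n M} {θ : OneForm n M} {lam : M → ℝ} {φ : BilinForm n M}

theorem ric_chartMetric_eq (h : IsYorkDecomposition g θ lam φ)
    (hy : y ∈ (extChartAt (𝓡 n) c).target) :
    ric (chartMetric g c) =ᶠ[𝓝 y] (1 / 2 : ℝ) • lieBil (chartSharp g θ c) (chartMetric g c)
      + (fun z => lam ((extChartAt (𝓡 n) c).symm z)) • chartMetric g c + chartBil c φ := by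
  filter_upwards [target_mem_nhds hy] with z hz
  refine ContinuousLinearMap.ext fun v => ContinuousLinearMap.ext fun w => ?_
  rw [← hasTensorExpr_ricci g c z hz, h.eq, deltaStar, (hasTensorExpr_chartMetric g c).lieDeriv_eq
    (isMetricNear_chartMetric g hz).differentiableAt (hasCoordExpr_sharp g h.smooth_form hz),
    hasTensorExpr_chartMetric g c z hz]
  rfl

theorem sum_nablaBil_eq_zero (h : IsYorkDecomposition g θ lam φ)
    (hy : y ∈ (extChartAt (𝓡 n) c).target) {e : Basis (Fin n) ℝ ℝ^n}
    (he : ∀ i, orthoFrame g.tensor ((extChartAt (𝓡 n) c).symm y) i = chartFrame c y (e i))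
    (z : ℝ^n) : ∑ i, nablaBil (chartMetric g c) (chartBil c φ) y (e i) (e i) z = 0 := by
  rw [← neg_eq_zero, ← h.tt.divergence_eq_zero ((extChartAt (𝓡 n) c).symm y) (chartFrame c y z),
    divergence, traceAt]
  refine congrArg Neg.neg (Finset.sum_congr rfl fun i _ => ?_)
  rw [he, (hasTensorExpr_chartMetric g c).covDeriv_eq (isMetricNear_chartMetric g hy)
    (hasTensorExpr_chartBil c φ) hy
    ((contDiffAt_chartBil h.tt.smooth hy).differentiableAt (by simp))]

theorem fderiv_lam_eq_zero (h : IsYorkDecomposition g θ lam φ) (hn : n ≠ 2)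
    (hξ : IsInfinitesimalHarmonic g.tensor (sharp g.tensor θ))
    (hy : y ∈ (extChartAt (𝓡 n) c).target) :
    fderiv ℝ (fun z => lam ((extChartAt (𝓡 n) c).symm z)) y = 0 := by
  obtain ⟨e, he, hf⟩ := exists_isOrthonormal_orthoFrame g hy
  have hG := isMetricNear_chartMetric g hy
  have hsharp := hasCoordExpr_sharp g h.smooth_form hy
  have hharm : ∑ i, lieConn (christoffel (chartMetric g c)) (chartSharp g θ c) y (e i) (e i)
      = 0 := by
    refine chartFrame_injective hy ?_
    rw [map_zero (chartFrame c y), ← hξ ((extChartAt (𝓡 n) c).symm y), traceAt, map_sum]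
    refine Finset.sum_congr rfl fun i _ => ?_
    rw [hf, (hasTensorExpr_chartMetric g c).lieDerivConnection_eq hG hsharp]
  have htr : ∀ᶠ z in 𝓝 y, trBil (chartMetric g c z) (chartBil c φ z) = 0 := by
    filter_upwards [target_mem_nhds hy] with z hz
    rw [← traceAt_eq g hz (hasTensorExpr_chartBil c φ z hz), h.tt.trace_eq_zero]
  exact hG.fderiv_eq_zero_of_york (eventually_isInner_chartMetric g hy) he (by simpa using hn)
    hsharp.contDiffAt ((contDiffAt_comp_chart_symm h.smooth_lam hy).differentiableAt (by simp))
    ((contDiffAt_chartBil h.tt.smooth hy).differentiableAt (by simp)) (h.ric_chartMetric_eq hy)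
    hharm (h.sum_nablaBil_eq_zero hy hf) htr

theorem lam_const [PreconnectedSpace M] (h : IsYorkDecomposition g θ lam φ) (hn : n ≠ 2)
    (hξ : IsInfinitesimalHarmonic g.tensor (sharp g.tensor θ)) (x x' : M) : lam x = lam x' := by
  refine IsLocallyConstant.apply_eq_of_preconnectedSpace ?_ x x'
  rw [IsLocallyConstant.iff_eventually_eq]
  intro x
  obtain ⟨r, hr, hball⟩ := Metric.isOpen_iff.1 (isOpen_extChartAt_target (I := 𝓡 n) x) _
    (mem_extChartAt_target x)
  filter_upwards [(continuousAt_extChartAt (I := 𝓡 n) x).preimage_mem_nhds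
    (Metric.ball_mem_nhds _ hr), extChartAt_source_mem_nhds (I := 𝓡 n) x] with z hz hzs
  have hc := Metric.isOpen_ball.is_const_of_fderiv_eq_zero (𝕜 := ℝ)
    (f := fun y => lam ((extChartAt (𝓡 n) x).symm y)) Metric.isPreconnected_ball
    (fun y hy => ((contDiffAt_comp_chart_symm h.smooth_lam (hball hy)).differentiableAt
      (by simp)).differentiableWithinAt)
    (fun y hy => h.fderiv_lam_eq_zero hn hξ (hball hy)) hz (Metric.mem_ball_self hr)
  simpa only [(extChartAt (𝓡 n) x).left_inv hzs, extChartAt_to_inv x] using hc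

theorem scalarCurvature_eq (h : IsYorkDecomposition g θ lam φ) (x : M) :
    scalarCurvature g.tensor x = traceAt g.tensor x (deltaStar g.tensor θ x) + n * lam x := by
  revert x
  refine forall_of_chart (n := n) fun c y hy => ?_
  obtain ⟨e, he, hf⟩ := exists_isOrthonormal_orthoFrame g hy
  have hφ := h.tt.trace_eq_zero ((extChartAt (𝓡 n) c).symm y)
  have hg : ∀ i, g.tensor _ (orthoFrame g.tensor ((extChartAt (𝓡 n) c).symm y) i)
      (orthoFrame g.tensor ((extChartAt (𝓡 n) c).symm y) i) = 1 := fun i => by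
    rw [hf, hasTensorExpr_chartMetric g c y hy, he, if_pos rfl]
  rw [traceAt] at hφ
  simp only [BilinForm.toTensor2] at hφ
  simp only [scalarCurvature, traceAt, h.eq, hg, Finset.sum_add_distrib, hφ, mul_one,
    Finset.sum_const, Finset.card_univ, Fintype.card_fin, nsmul_eq_mul, add_zero]

end IsYorkDecomposition

end York

section Volume

/-- The transition map from the chart at `c` to the chart at `c'`. -/
noncomputable def transition (c c' : M) (y : ℝ^n) : ℝ^n :=
  extChartAt (𝓡 n) c' ((extChartAt (𝓡 n) c).symm y)

theorem injOn_transition (c c' : M) : Set.InjOn (transition (n := n) c c')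
    ((extChartAt (𝓡 n) c).target ∩
      (extChartAt (𝓡 n) c).symm ⁻¹' (extChartAt (𝓡 n) c').source) :=
  fun _ hy _ hz h => (extChartAt (𝓡 n) c).symm.injOn hy.1 hz.1
    ((extChartAt (𝓡 n) c').injOn hy.2 hz.2 h)

theorem image_transition (c c' : M) {s : Set M} (hs : s ⊆ (extChartAt (𝓡 n) c).source)
    (hs' : s ⊆ (extChartAt (𝓡 n) c').source) :
    transition c c' '' ((extChartAt (𝓡 n) c).target ∩ (extChartAt (𝓡 n) c).symm ⁻¹' s) =
      (extChartAt (𝓡 n) c').target ∩ (extChartAt (𝓡 n) c').symm ⁻¹' s := by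
  rw [← (extChartAt (𝓡 n) c).image_eq_target_inter_inv_preimage hs,
    ← (extChartAt (𝓡 n) c').image_eq_target_inter_inv_preimage hs', Set.image_image]
  exact Set.image_congr fun x hx =>
    congrArg (extChartAt (𝓡 n) c') ((extChartAt (𝓡 n) c).left_inv (hs hx))

section Metric

variable [IsManifold (𝓡 n) ∞ M] {c c' : M} {y : ℝ^n}

theorem differentiableAt_transition (hy : y ∈ (extChartAt (𝓡 n) c).target)
    (hx : (extChartAt (𝓡 n) c).symm y ∈ (extChartAt (𝓡 n) c').source) :
    DifferentiableAt ℝ (transition c c') y :=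
  ((mdifferentiableAt_extChartAt (by rwa [← extChartAt_source (𝓡 n)])).comp y
    ((contMDiffAt_symm hy).mdifferentiableAt (by simp))).differentiableAt

-- Both sides lie in the model of the tangent spaces at the two, propositionally equal, points
-- `(extChartAt (𝓡 n) c).symm y` and `(extChartAt (𝓡 n) c').symm (transition c c' y)`.
theorem chartFrame_transition (hy : y ∈ (extChartAt (𝓡 n) c).target)
    (hx : (extChartAt (𝓡 n) c).symm y ∈ (extChartAt (𝓡 n) c').source) (v : ℝ^n) :
    Eq (α := ℝ^n) (chartFrame c y v)
      (chartFrame c' (transition c c' y) (fderiv ℝ (transition c c') y v)) := by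
  have hsymm : (extChartAt (𝓡 n) c).symm =ᶠ[𝓝 y]
      (extChartAt (𝓡 n) c').symm ∘ transition c c' := by
    filter_upwards [tendsto_chart_symm hy
      ((isOpen_extChartAt_source (I := 𝓡 n) c').mem_nhds hx)] with z hz
    exact ((extChartAt (𝓡 n) c').left_inv hz).symm
  have hcomp := mfderiv_comp y
    ((contMDiffAt_symm ((extChartAt (𝓡 n) c').map_source hx)).mdifferentiableAt (by simp))
    (differentiableAt_transition hy hx).mdifferentiableAt
  rw [mfderiv_eq_fderiv] at hcomp
  exact congrArg (fun T : ℝ^n →L[ℝ] ℝ^n => T v) (hsymm.mfderiv_eq.trans hcomp)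

theorem chartMetric_transition (g : Metric n M) (hy : y ∈ (extChartAt (𝓡 n) c).target)
    (hx : (extChartAt (𝓡 n) c).symm y ∈ (extChartAt (𝓡 n) c').source) :
    chartMetric g c y = (chartMetric g c' (transition c c' y)).bilinearComp
      (fderiv ℝ (transition c c') y) (fderiv ℝ (transition c c') y) := by
  have hpoint : (extChartAt (𝓡 n) c').symm (transition c c' y) = (extChartAt (𝓡 n) c).symm y :=
    (extChartAt (𝓡 n) c').left_inv hx
  let F : M → ℝ^n → ℝ^n → ℝ := g.tensor
  ext v w
  change F _ (chartFrame c y v) (chartFrame c y w) =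
    F ((extChartAt (𝓡 n) c').symm (transition c c' y)) _ _
  rw [hpoint]
  exact congrArg₂ (F _) (chartFrame_transition hy hx v) (chartFrame_transition hy hx w)

/-- The density of the Riemannian measure in the chart at `c`, in the standard basis of `ℝⁿ`. -/
noncomputable def chartDensity (g : Metric n M) (c : M) : ℝ^n → ℝ :=
  density (EuclideanSpace.basisFun (Fin n) ℝ).toBasis (chartMetric g c)

theorem volDensity_eq_chartDensity (g : Metric n M) (c : M) :
    volDensity g.tensor c = chartDensity g c := by
  ext y
  simp only [volDensity, chartDensity, density, gramDet]
  congr 2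

theorem chartDensity_transition (g : Metric n M) (hy : y ∈ (extChartAt (𝓡 n) c).target)
    (hx : (extChartAt (𝓡 n) c).symm y ∈ (extChartAt (𝓡 n) c').source) :
    chartDensity g c y = |(fderiv ℝ (transition c c') y).det| *
      chartDensity g c' (transition c c' y) := by
  rw [chartDensity, density, chartMetric_transition g hy hx, gramDet_bilinearComp,
    Real.sqrt_mul (sq_nonneg _), Real.sqrt_sq_eq_abs, chartDensity, density]

theorem contDiffAt_chartDensity (g : Metric n M) (hy : y ∈ (extChartAt (𝓡 n) c).target) :
    ContDiffAt ℝ ∞ (chartDensity g c) y :=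
  contDiffAt_density (isMetricNear_chartMetric g hy).contDiffAt (isInner_chartMetric g hy)

theorem continuousOn_chartDensity (g : Metric n M) (c : M) :
    ContinuousOn (chartDensity g c) (extChartAt (𝓡 n) c).target := fun _ hy =>
  (contDiffAt_chartDensity g hy).continuousAt.continuousWithinAt

end Metric

variable [MeasurableSpace M] [BorelSpace M]

theorem aemeasurable_chart_symm (h : Tensor2 n M) (c : M) :
    AEMeasurable (extChartAt (𝓡 n) c).symm
      ((volume.restrict (extChartAt (𝓡 n) c).target).withDensity fun y =>
        ENNReal.ofReal (volDensity h c y)) :=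
  ((continuousOn_extChartAt_symm c).aemeasurable
    (isOpen_extChartAt_target (I := 𝓡 n) c).measurableSet).mono_ac
    (withDensity_absolutelyContinuous _ _)

theorem chartVolume_apply (h : Tensor2 n M) (c : M) {s : Set M} (hs : MeasurableSet s) :
    chartVolume h c s =
      ∫⁻ y in (extChartAt (𝓡 n) c).target ∩ (extChartAt (𝓡 n) c).symm ⁻¹' s,
        ENNReal.ofReal (volDensity h c y) := by
  rw [chartVolume, Measure.map_apply_of_aemeasurable (aemeasurable_chart_symm h c) hs,
    withDensity_apply', Measure.restrict_restrict'
      (isOpen_extChartAt_target (I := 𝓡 n) c).measurableSet, Set.inter_comm]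

theorem chartVolume_restrict_source (h : Tensor2 n M) (c : M) :
    (chartVolume h c).restrict (extChartAt (𝓡 n) c).source = chartVolume h c := by
  have hsource : MeasurableSet (extChartAt (𝓡 n) c).source :=
    (isOpen_extChartAt_source (I := 𝓡 n) c).measurableSet
  refine Measure.restrict_eq_self_of_ae_mem ?_
  change chartVolume h c (extChartAt (𝓡 n) c).sourceᶜ = 0
  rw [chartVolume_apply _ _ hsource.compl, Set.preimage_compl, ← Set.sdiff_eq,
    Set.sdiff_eq_empty.2 (extChartAt (𝓡 n) c).target_subset_preimage_source, Measure.restrict_empty,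
    lintegral_zero_measure]

theorem measurableSet_target_inter_preimage (c : M) {s : Set M} (hs : MeasurableSet s) :
    MeasurableSet ((extChartAt (𝓡 n) c).target ∩ (extChartAt (𝓡 n) c).symm ⁻¹' s) := by
  have hcont : Continuous ((extChartAt (𝓡 n) c).target.domRestrict (extChartAt (𝓡 n) c).symm) :=
    continuousOn_iff_continuous_domRestrict.1 (continuousOn_extChartAt_symm c)
  have himage := (isOpen_extChartAt_target (I := 𝓡 n) c).measurableSet.subtype_image
    (hcont.measurable hs)
  rwa [Set.domRestrict_eq, Set.preimage_comp, Subtype.image_preimage_coe] at himage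

variable [IsManifold (𝓡 n) ∞ M]

theorem chartVolume_eq (g : Metric n M) (c c' : M) {s : Set M} (hs : MeasurableSet s)
    (h : s ⊆ (extChartAt (𝓡 n) c).source) (h' : s ⊆ (extChartAt (𝓡 n) c').source) :
    chartVolume g.tensor c s = chartVolume g.tensor c' s := by
  have hsub : (extChartAt (𝓡 n) c).target ∩ (extChartAt (𝓡 n) c).symm ⁻¹' s ⊆
      (extChartAt (𝓡 n) c).target ∩
        (extChartAt (𝓡 n) c).symm ⁻¹' (extChartAt (𝓡 n) c').source :=
    Set.inter_subset_inter_right _ (Set.preimage_mono h')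
  have hm := measurableSet_target_inter_preimage (n := n) c hs
  rw [chartVolume_apply _ _ hs, chartVolume_apply _ _ hs, ← image_transition c c' h h',
    lintegral_image_eq_lintegral_abs_det_fderiv_mul volume hm
      (fun y hy => (differentiableAt_transition (hsub hy).1
        (hsub hy).2).hasFDerivAt.hasFDerivWithinAt) ((injOn_transition c c').mono hsub)]
  refine setLIntegral_congr_fun hm fun y hy => ?_
  rw [← ENNReal.ofReal_mul (abs_nonneg _), volDensity_eq_chartDensity, volDensity_eq_chartDensity,
    chartDensity_transition g (hsub hy).1 (hsub hy).2]

theorem chartVolume_restrict_eq (g : Metric n M) (c c' : M) {s : Set M} (hs : MeasurableSet s)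
    (h : s ⊆ (extChartAt (𝓡 n) c).source) (h' : s ⊆ (extChartAt (𝓡 n) c').source) :
    (chartVolume g.tensor c).restrict s = (chartVolume g.tensor c').restrict s := by
  ext t ht
  rw [Measure.restrict_apply ht, Measure.restrict_apply ht]
  exact chartVolume_eq g c c' (ht.inter hs) (Set.inter_subset_right.trans h)
    (Set.inter_subset_right.trans h')

theorem integral_chartVolume (g : Metric n M) (c : M) {F : M → ℝ}
    (hF : AEStronglyMeasurable F (chartVolume g.tensor c)) :
    ∫ x, F x ∂(chartVolume g.tensor c) = ∫ y in (extChartAt (𝓡 n) c).target,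
      chartDensity g c y * F ((extChartAt (𝓡 n) c).symm y) := by
  rw [chartVolume, integral_map (aemeasurable_chart_symm _ _) hF,
    integral_withDensity_eq_integral_toReal_smul₀]
  · refine integral_congr_ae (ae_of_all _ fun y => ?_)
    simp only [smul_eq_mul, volDensity_eq_chartDensity]
    rw [ENNReal.toReal_ofReal (show 0 ≤ chartDensity g c y from Real.sqrt_nonneg _)]
  · rw [volDensity_eq_chartDensity]
    exact ((continuousOn_chartDensity g c).aemeasurable
      (isOpen_extChartAt_target (I := 𝓡 n) c).measurableSet).ennreal_ofReal
  · exact ae_of_all _ fun _ => ENNReal.ofReal_lt_top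

theorem chartVolume_lt_top_of_isCompact [T2Space M] (g : Metric n M) (c : M) {K : Set M}
    (hK : IsCompact K) (hKc : K ⊆ (extChartAt (𝓡 n) c).source) :
    chartVolume g.tensor c K < ⊤ := by
  have himage := (extChartAt (𝓡 n) c).image_eq_target_inter_inv_preimage hKc
  have hint : IntegrableOn (chartDensity g c) (extChartAt (𝓡 n) c '' K) :=
    ((continuousOn_chartDensity g c).mono (himage.trans_subset
      Set.inter_subset_left)).integrableOn_compact
      (hK.image_of_continuousOn ((continuousOn_extChartAt c).mono hKc))
  rw [chartVolume_apply _ _ hK.measurableSet, ← himage, volDensity_eq_chartDensity]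
  exact hint.lintegral_lt_top

end Volume

section Partition

variable [IsManifold (𝓡 n) ∞ M] [T2Space M] [CompactSpace M]

theorem tsupport_chartPartition_subset (c : M) :
    tsupport (chartPartition n M c) ⊆ (extChartAt (𝓡 n) c).source :=
  ((SmoothPartitionOfUnity.exists_isSubordinate_chartAt_source (𝓡 n) M).choose_spec c).trans_eq
    (extChartAt_source (𝓡 n) c).symm

variable (n M) in
/-- The indices of the partition functions that do not vanish identically. -/
noncomputable def partitionFinset : Finset M :=
  (chartPartition n M).locallyFinite.finite_nonempty_of_compact.toFinset

theorem chartPartition_eq_zero {c : M} (hc : c ∉ partitionFinset n M) (x : M) :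
    chartPartition n M c x = 0 := by
  by_contra hx
  exact hc ((Set.Finite.mem_toFinset _).2 ⟨x, hx⟩)

theorem sum_chartPartition (x : M) : ∑ c ∈ partitionFinset n M, chartPartition n M c x = 1 := by
  rw [← (chartPartition n M).sum_eq_one (Set.mem_univ x)]
  refine (finsum_eq_sum_of_support_subset _ fun c hc => ?_).symm
  by_contra h
  exact hc (chartPartition_eq_zero h x)

variable [MeasurableSpace M]

theorem volumeMeasure_eq_sum (h : Tensor2 n M) : volumeMeasure h =
    ∑ c ∈ partitionFinset n M,
      (chartVolume h c).withDensity fun x => ENNReal.ofReal (chartPartition n M c x) := by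
  ext s hs
  rw [volumeMeasure, Measure.sum_apply _ hs, Measure.finsetSum_apply]
  refine tsum_eq_sum fun c hc => ?_
  simp only [chartPartition_eq_zero hc, ENNReal.ofReal_zero]
  rw [withDensity_apply _ hs, lintegral_zero]

variable [BorelSpace M]

theorem withDensity_chartPartition_lt_top (g : Metric n M) (c : M) :
    (chartVolume g.tensor c).withDensity (fun x => ENNReal.ofReal (chartPartition n M c x))
      Set.univ < ⊤ := by
  have hK : IsCompact (tsupport (chartPartition n M c)) := (isClosed_tsupport _).isCompact
  rw [withDensity_apply _ MeasurableSet.univ, Measure.restrict_univ]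
  refine lt_of_le_of_lt ?_
    (chartVolume_lt_top_of_isCompact g c hK (tsupport_chartPartition_subset c))
  rw [← lintegral_indicator_one hK.measurableSet]
  refine lintegral_mono fun x => ?_
  by_cases hx : x ∈ tsupport (chartPartition n M c)
  · rw [Set.indicator_of_mem hx]
    exact ENNReal.ofReal_le_one.2 ((chartPartition n M).le_one c x)
  · rw [image_eq_zero_of_notMem_tsupport hx, ENNReal.ofReal_zero]
    exact zero_le

theorem isFiniteMeasure_volumeMeasure (g : Metric n M) :
    IsFiniteMeasure (volumeMeasure g.tensor) := by
  refine ⟨?_⟩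
  rw [volumeMeasure_eq_sum, Measure.finsetSum_apply]
  exact ENNReal.sum_lt_top.2 fun c _ => withDensity_chartPartition_lt_top g c

theorem setLIntegral_chartPartition (g : Metric n M) (c c' : M) {s : Set M} (hs : MeasurableSet s)
    (h : s ⊆ (extChartAt (𝓡 n) c).source) :
    ∫⁻ x in s, ENNReal.ofReal (chartPartition n M c' x) ∂(chartVolume g.tensor c') =
      ∫⁻ x in s, ENNReal.ofReal (chartPartition n M c' x) ∂(chartVolume g.tensor c) := by
  have hsource : MeasurableSet (extChartAt (𝓡 n) c').source :=
    (isOpen_extChartAt_source (I := 𝓡 n) c').measurableSet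
  have hindicator : (fun x => ENNReal.ofReal (chartPartition n M c' x)) =
      (extChartAt (𝓡 n) c').source.indicator
        fun x => ENNReal.ofReal (chartPartition n M c' x) := by
    refine (Set.indicator_eq_self.2 fun x hx => ?_).symm
    by_contra hxs
    refine hx (ENNReal.ofReal_eq_zero.2 (le_of_eq ?_))
    exact image_eq_zero_of_notMem_tsupport fun ht => hxs (tsupport_chartPartition_subset c' ht)
  rw [hindicator, setLIntegral_indicator hsource, setLIntegral_indicator hsource,
    chartVolume_restrict_eq g c' c (hsource.inter hs) Set.inter_subset_left
      (Set.inter_subset_right.trans h)]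

theorem volumeMeasure_restrict_source (g : Metric n M) (c : M) :
    (volumeMeasure g.tensor).restrict (extChartAt (𝓡 n) c).source = chartVolume g.tensor c := by
  rw [← chartVolume_restrict_source]
  ext t ht
  have hs := ht.inter (isOpen_extChartAt_source (I := 𝓡 n) c).measurableSet
  rw [Measure.restrict_apply ht, Measure.restrict_apply ht]
  calc volumeMeasure g.tensor (t ∩ (extChartAt (𝓡 n) c).source)
    _ = ∑ c' ∈ partitionFinset n M, ∫⁻ x in t ∩ (extChartAt (𝓡 n) c).source,
          ENNReal.ofReal (chartPartition n M c' x) ∂(chartVolume g.tensor c) := by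
      rw [volumeMeasure_eq_sum, Measure.finsetSum_apply]
      refine Finset.sum_congr rfl fun c' _ => ?_
      rw [withDensity_apply _ hs, setLIntegral_chartPartition g c c' hs Set.inter_subset_right]
    _ = ∫⁻ x in t ∩ (extChartAt (𝓡 n) c).source, ENNReal.ofReal
          (∑ c' ∈ partitionFinset n M, chartPartition n M c' x) ∂(chartVolume g.tensor c) := by
      rw [← lintegral_finsetSum _ fun c' _ =>
        (chartPartition n M c').contMDiff.continuous.measurable.ennreal_ofReal]
      exact lintegral_congr fun x => (ENNReal.ofReal_sum_of_nonneg fun c' _ =>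
        (chartPartition n M).nonneg c' x).symm
    _ = chartVolume g.tensor c (t ∩ (extChartAt (𝓡 n) c).source) := by
      simp only [sum_chartPartition, ENNReal.ofReal_one, lintegral_one, Measure.restrict_apply_univ]

end Partition

section DivergenceTheorem

theorem continuous_of_chart {F : M → ℝ}
    (h : ∀ c : M, ∀ y ∈ (extChartAt (𝓡 n) c).target,
      ContinuousAt (fun z => F ((extChartAt (𝓡 n) c).symm z)) y) : Continuous F := by
  refine continuous_iff_continuousAt.2 fun x => ?_
  have hcomp := ContinuousAt.comp (f := extChartAt (𝓡 n) x)
    (h x _ (mem_extChartAt_target x)) (continuousAt_extChartAt x)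
  refine hcomp.congr ?_
  filter_upwards [extChartAt_source_mem_nhds (I := 𝓡 n) x] with z hz
  exact congrArg F ((extChartAt (𝓡 n) x).left_inv hz)

variable [IsManifold (𝓡 n) ∞ M]

/-- Smooth vector fields. -/
def IsSmoothVField (ξ : VField n M) : Prop :=
  ContMDiff (𝓡 n) (𝓡 n).tangent ∞ fun x => TotalSpace.mk' ℝ^n x (ξ x)

/-- The divergence of the vector field `ξ`, as half the trace of `L_ξ g`. -/
noncomputable def vectorDiv (g : Metric n M) (ξ : VField n M) (x : M) : ℝ :=
  (1 / 2) * traceAt g.tensor x (lieDeriv ξ g.tensor x)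

variable {c : M} {y : ℝ^n} {ξ : VField n M}

theorem IsSmoothVField.hasCoordExpr (hξ : IsSmoothVField ξ)
    (hy : y ∈ (extChartAt (𝓡 n) c).target) : HasCoordExpr c ξ (chartVField c ξ) y :=
  hasCoordExpr_chartVField hy (Eventually.of_forall hξ)

theorem isSmoothVField_sharp (g : Metric n M) {θ : OneForm n M} (hθ : IsSmoothOneForm θ) :
    IsSmoothVField (sharp g.tensor θ) :=
  forall_of_chart (n := n) fun _ _ hy => (hasCoordExpr_sharp g hθ hy).contMDiffAt

theorem traceAt_deltaStar (g : Metric n M) (θ : OneForm n M) (x : M) :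
    traceAt g.tensor x (deltaStar g.tensor θ x) = vectorDiv g (sharp g.tensor θ) x :=
  (Finset.mul_sum _ _ _).symm

theorem vectorDiv_eq (g : Metric n M) {V : ℝ^n → ℝ^n} (hξ : HasCoordExpr c ξ V y) :
    vectorDiv g ξ ((extChartAt (𝓡 n) c).symm y) =
      (1 / 2) * trBil (chartMetric g c y) (lieBil V (chartMetric g c) y) := by
  have hy := hξ.mem_target
  rw [vectorDiv, traceAt_eq g hy fun a b => (hasTensorExpr_chartMetric g c).lieDeriv_eq
    (isMetricNear_chartMetric g hy).differentiableAt hξ a b]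

theorem continuous_vectorDiv (g : Metric n M) (hξ : IsSmoothVField ξ) :
    Continuous (vectorDiv g ξ) := by
  refine continuous_of_chart (n := n) fun c y hy => ?_
  have hG := isMetricNear_chartMetric g hy
  have hlie := contDiffAt_lieBil (hξ.hasCoordExpr hy).contDiffAt hG.contDiffAt
  refine ((hG.contDiffAt_trBil hlie).continuousAt.const_mul (1 / 2)).congr ?_
  filter_upwards [target_mem_nhds hy] with z hz
  exact (vectorDiv_eq g (hξ.hasCoordExpr hz)).symm

theorem vectorDiv_sum (g : Metric n M) {ι : Type*} (s : Finset ι) {η : ι → VField n M}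
    (hη : ∀ i, IsSmoothVField (η i)) (x : M) :
    vectorDiv g (∑ i ∈ s, η i) x = ∑ i ∈ s, vectorDiv g (η i) x := by
  refine forall_of_chart (n := n) (P := fun x => vectorDiv g (∑ i ∈ s, η i) x =
    ∑ i ∈ s, vectorDiv g (η i) x) (fun c y hy => ?_) x
  have hexpr := fun i => (hη i).hasCoordExpr hy
  have hsum : HasCoordExpr c (∑ i ∈ s, η i) (fun z => ∑ i ∈ s, chartVField c (η i) z) y := by
    filter_upwards [target_mem_nhds hy] with z hz
    have hz' := fun i => (hη i).hasCoordExpr hz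
    refine ⟨hz, ContDiffAt.sum fun i _ => (hz' i).contDiffAt, ?_⟩
    rw [Finset.sum_apply, map_sum]
    exact Finset.sum_congr rfl fun i _ => (hz' i).eq
  rw [vectorDiv_eq g hsum, Finset.sum_congr rfl fun i _ => vectorDiv_eq g (hexpr i),
    ← Finset.mul_sum, lieBil_sum _ fun i _ => (hexpr i).differentiableAt]
  simp only [trBil, ContinuousLinearMap.comp_finsetSum, map_sum]

theorem IsSmoothVField.contDiffAt_chartDensity_smul (g : Metric n M) (hξ : IsSmoothVField ξ)
    (hy : y ∈ (extChartAt (𝓡 n) c).target) :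
    ContDiffAt ℝ ∞ (fun z => chartDensity g c z • chartVField c ξ z) y :=
  (contDiffAt_chartDensity g hy).smul (hξ.hasCoordExpr hy).contDiffAt

theorem traceL_fderiv_chartDensity_smul (g : Metric n M) (hξ : IsSmoothVField ξ)
    (hy : y ∈ (extChartAt (𝓡 n) c).target) :
    traceL ℝ^n (fderiv ℝ (fun z => chartDensity g c z • chartVField c ξ z) y) =
      chartDensity g c y * vectorDiv g ξ ((extChartAt (𝓡 n) c).symm y) := by
  have hξy := hξ.hasCoordExpr hy
  rw [vectorDiv_eq g hξy]
  exact traceL_fderiv_density_smul (isMetricNear_chartMetric g hy).differentiableAt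
    (isInner_chartMetric g hy) ((contDiffAt_chartDensity g hy).differentiableAt (by simp))
    hξy.differentiableAt

theorem vectorDiv_eq_zero_of_eventuallyEq (g : Metric n M) {x : M} (hξ : ∀ᶠ z in 𝓝 x, ξ z = 0) :
    vectorDiv g ξ x = 0 := by
  revert hξ
  refine forall_of_chart (n := n) (P := fun x => (∀ᶠ z in 𝓝 x, ξ z = 0) → vectorDiv g ξ x = 0)
    (fun c y hy hξ => ?_) x
  have hexpr : HasCoordExpr c ξ (fun _ => 0) y := by
    filter_upwards [target_mem_nhds hy, (tendsto_chart_symm hy).eventually hξ] with z hz hξz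
    exact ⟨hz, contDiffAt_const, hξz.trans (map_zero _).symm⟩
  rw [vectorDiv_eq g hexpr]
  simp [lieBil, trBil]

variable [MeasurableSpace M] [BorelSpace M]

theorem integral_chartVolume_vectorDiv (g : Metric n M) (hξ : IsSmoothVField ξ) {K : Set M}
    (hK : IsCompact K) (hKc : K ⊆ (extChartAt (𝓡 n) c).source) (hzero : ∀ x ∉ K, ξ x = 0) :
    ∫ x, vectorDiv g ξ x ∂(chartVolume g.tensor c) = 0 := by
  rw [integral_chartVolume g c (continuous_vectorDiv g hξ).aestronglyMeasurable]
  have hopen := isOpen_extChartAt_target (I := 𝓡 n) c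
  rw [← setIntegral_traceL_fderiv_eq_zero volume hopen
    (hK.image_of_continuousOn ((continuousOn_extChartAt c).mono hKc))
    (Set.image_subset_iff.2 fun x hx => (extChartAt (𝓡 n) c).map_source (hKc hx))
    (W := fun z => chartDensity g c z • chartVField c ξ z)]
  · exact setIntegral_congr_fun hopen.measurableSet fun y hy =>
      (traceL_fderiv_chartDensity_smul g hξ hy).symm
  · exact fun y hy => ((hξ.contDiffAt_chartDensity_smul g hy).of_le (by simp)).contDiffWithinAt
  · intro y hy hyK
    rw [chartVField, hzero _ fun h => hyK ⟨_, h, (extChartAt (𝓡 n) c).right_inv hy⟩, map_zero,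
      smul_zero]

variable [T2Space M] [CompactSpace M]

theorem integral_vectorDiv_of_support_subset (g : Metric n M) (hξ : IsSmoothVField ξ)
    {K : Set M} (hK : IsClosed K) (hKc : K ⊆ (extChartAt (𝓡 n) c).source)
    (hzero : ∀ x ∉ K, ξ x = 0) :
    ∫ x, vectorDiv g ξ x ∂(volumeMeasure g.tensor) = 0 := by
  rw [← integral_chartVolume_vectorDiv g hξ hK.isCompact hKc hzero,
    ← volumeMeasure_restrict_source g c]
  refine (setIntegral_eq_integral_of_forall_compl_eq_zero fun x hx => ?_).symm
  refine vectorDiv_eq_zero_of_eventuallyEq g ?_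
  filter_upwards [hK.isOpen_compl.mem_nhds fun h => hx (hKc h)] with z hz using hzero z hz

theorem integrable_vectorDiv (g : Metric n M) (hξ : IsSmoothVField ξ) :
    Integrable (vectorDiv g ξ) (volumeMeasure g.tensor) :=
  have := isFiniteMeasure_volumeMeasure g
  (continuous_vectorDiv g hξ).integrable_of_hasCompactSupport
    (HasCompactSupport.of_compactSpace _)

theorem integral_vectorDiv (g : Metric n M) (hξ : IsSmoothVField ξ) :
    ∫ x, vectorDiv g ξ x ∂(volumeMeasure g.tensor) = 0 := by
  let η : M → VField n M := fun c x => chartPartition n M c x • ξ x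
  have hη : ∀ c, IsSmoothVField (η c) := fun c =>
    ContMDiff.smul_section (chartPartition n M c).contMDiff hξ
  have hsum : ∑ c ∈ partitionFinset n M, η c = ξ := funext fun x => by
    rw [Finset.sum_apply, ← Finset.sum_smul, sum_chartPartition, one_smul]
  rw [← hsum]
  simp only [vectorDiv_sum g _ hη]
  rw [integral_finsetSum _ fun c _ => integrable_vectorDiv g (hη c)]
  refine Finset.sum_eq_zero fun c _ => integral_vectorDiv_of_support_subset g (hη c)
    (isClosed_tsupport _) (tsupport_chartPartition_subset c) fun x hx => ?_
  exact (congrArg (· • ξ x) (image_eq_zero_of_notMem_tsupport hx)).trans (zero_smul ℝ _)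

end DivergenceTheorem

theorem energyDensity_id (g h : Tensor2 n M) (x : M) :
    energyDensity g h (id : M → M) x = traceAt g x (h x) := by
  have hpullback : pullback (id : M → M) h x = h x := by
    funext v w
    rw [pullback, mfderiv_id]
    rfl
  rw [energyDensity, hpullback]

section Energy

variable [IsManifold (𝓡 n) ∞ M] [T2Space M] [CompactSpace M] [MeasurableSpace M]

theorem integral_energyDensity_id_ricci (g : Tensor2 n M) :
    ∫ x, energyDensity g (ricci g) (id : M → M) x ∂(volumeMeasure g) = totalScalarCurvature g :=
  integral_congr_ae (ae_of_all _ (energyDensity_id g (ricci g)))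

theorem energy_id_ricci (g : Tensor2 n M) :
    energy g (ricci g) (id : M → M) = (1 / 2) * totalScalarCurvature g := by
  rw [energy, integral_energyDensity_id_ricci]

variable [BorelSpace M]

theorem IsYorkDecomposition.totalScalarCurvature_eq {g : Metric n M} {θ : OneForm n M}
    {lam : M → ℝ} {φ : BilinForm n M} (h : IsYorkDecomposition g θ lam φ) {k : ℝ}
    (hk : ∀ x, lam x = k) : totalScalarCurvature g.tensor = n * k * vol g.tensor := by
  have := isFiniteMeasure_volumeMeasure g
  have hsmooth := isSmoothVField_sharp g h.smooth_form
  calc totalScalarCurvature g.tensor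
    _ = ∫ x, vectorDiv g (sharp g.tensor θ) x + n * k ∂(volumeMeasure g.tensor) :=
      integral_congr_ae (ae_of_all _ fun x => by
        rw [h.scalarCurvature_eq, traceAt_deltaStar, hk])
    _ = n * k * vol g.tensor := by
      rw [integral_add (integrable_vectorDiv g hsmooth) (integrable_const _),
        integral_vectorDiv g hsmooth, integral_const, smul_eq_mul, zero_add, mul_comm, vol]

end Energy

end RiemGeom

theorem corollary3_general {n : ℕ} (hn : n ≠ 2)
    {M : Type*} [TopologicalSpace M] [ChartedSpace (EuclideanSpace ℝ (Fin n)) M]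
    [IsManifold (𝓡 n) ∞ M] [T2Space M] [CompactSpace M] [PreconnectedSpace M]
    [MeasurableSpace M] [BorelSpace M] (g : RiemGeom.Metric n M) :
    ((∀ (x : M) (v : TangentSpace (𝓡 n) x), (∀ w, RiemGeom.ricci g.tensor x v w = 0) → v = 0) →
      RiemGeom.IsHarmonicId g.tensor (RiemGeom.ricci g.tensor)) ∧
    ∀ θ lam φ, RiemGeom.IsYorkDecomposition g θ lam φ →
      RiemGeom.IsInfinitesimalHarmonic g.tensor (RiemGeom.sharp g.tensor θ) →
      ∃ c : ℝ, (∀ x, lam x = c) ∧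
        ∫ x, RiemGeom.energyDensity g.tensor (RiemGeom.ricci g.tensor) (id : M → M) x
            ∂(RiemGeom.volumeMeasure g.tensor) = RiemGeom.totalScalarCurvature g.tensor ∧
        RiemGeom.energy g.tensor (RiemGeom.ricci g.tensor) (id : M → M) =
          (1 / 2) * RiemGeom.totalScalarCurvature g.tensor ∧
        RiemGeom.totalScalarCurvature g.tensor = n * c * RiemGeom.vol g.tensor := by
  refine ⟨RiemGeom.isHarmonicId_ricci g, fun θ lam φ hYork hξ => ?_⟩
  obtain ⟨c, hc⟩ : ∃ c, ∀ x, lam x = c := by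
    rcases isEmpty_or_nonempty M with _ | ⟨⟨x₀⟩⟩
    · exact ⟨0, isEmptyElim⟩
    · exact ⟨lam x₀, fun x => hYork.lam_const hn hξ x x₀⟩
  exact ⟨c, hc, RiemGeom.integral_energyDensity_id_ricci _, RiemGeom.energy_id_ricci _,
    hYork.totalScalarCurvature_eq hc⟩

theorem corollary3 {n : ℕ} (hn : 3 ≤ n)
    {M : Type*} [TopologicalSpace M] [ChartedSpace (EuclideanSpace ℝ (Fin n)) M]
    [IsManifold (𝓡 n) ∞ M] [T2Space M] [CompactSpace M] [ConnectedSpace M]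
    [MeasurableSpace M] [BorelSpace M]
    (g : RiemGeom.Metric n M)
    (hRic : ∀ (x : M) (v : TangentSpace (𝓡 n) x), v ≠ 0 → 0 < RiemGeom.ricci g.tensor x v v)
    (θ : RiemGeom.OneForm n M) (hθ : RiemGeom.IsSmoothOneForm θ)
    (lam : M → ℝ) (hlam : ContMDiff (𝓡 n) 𝓘(ℝ, ℝ) ∞ lam)
    (φ : RiemGeom.BilinForm n M) (hφ : RiemGeom.IsTT g.tensor φ)
    (hYork : ∀ (x : M) (v w : TangentSpace (𝓡 n) x),
      RiemGeom.ricci g.tensor x v w =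
        (RiemGeom.deltaStar g.tensor θ x v w + lam x * g.tensor x v w) + φ x v w) :
    RiemGeom.IsHarmonicId g.tensor (RiemGeom.ricci g.tensor) ∧
    (RiemGeom.IsInfinitesimalHarmonic g.tensor (RiemGeom.sharp g.tensor θ) →
      ∃ c : ℝ, (∀ x, lam x = c) ∧
        ∫ x, RiemGeom.energyDensity g.tensor (RiemGeom.ricci g.tensor) (id : M → M) x
            ∂(RiemGeom.volumeMeasure g.tensor) = RiemGeom.totalScalarCurvature g.tensor ∧
        RiemGeom.energy g.tensor (RiemGeom.ricci g.tensor) (id : M → M) =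
          (1 / 2) * RiemGeom.totalScalarCurvature g.tensor ∧
        RiemGeom.totalScalarCurvature g.tensor = n * c * RiemGeom.vol g.tensor) := by
  have hgen := corollary3_general (by lia : n ≠ 2) g
  exact ⟨hgen.1 fun x v hv => by_contra fun h => (hRic x v h).ne' (hv v),
    hgen.2 θ lam φ ⟨hθ, hlam, hφ, hYork⟩⟩
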